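/- **Setting.** Let $A\in\mathbb R^{m\times n}$ ($m,n\ge 1$) have at least one nonzero entry in every row and every column, let $b\in\mathbb R^n$, $c\in\mathbb R^m$, and $\epsilon>0$. Let $\mathbb B^k$ be the unit Euclidean ball of $\mathbb R^k$, $\mathcal Z=\mathbb B^n\times\mathbb B^m$, $f(x,y)=y^\top Ax+b^\top x-c^\top y$, $g(z)=(A^\top z^{\mathsf y}+b,\,-Az^{\mathsf x}+c)$, and $$\mathrm{Gap}(z)=\max_{y'\in\mathbb B^m}f(z^{\mathsf x},y')-\min_{x'\in\mathbb B^n}f(x',z^{\mathsf y}).$$ Let $\mathsf{nnz}$ be the number of nonzero entries of $A$, let $A_{i:}$ and $A_{:j}$ be its rows and columns, and put $$L=L_{\mathsf{co}}^{2,2}=\sqrt{\sum_i\|A_{i:}\|_1^2+\sum_j\|A_{:j}\|_1^2},\qquad \alpha=\max\{\epsilon,\ L\sqrt{1/\mathsf{nnz}}\}.$$ **Algorithm.** Put $\eta=\alpha/(20L^2)$, $\kappa=1/(1+\eta\alpha/2)$, $T=\lceil 6/(\eta\alpha)\rceil$, $K=\lceil\alpha/\epsilon\rceil$, and let $\Pi$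 be the Euclidean projection onto $\mathcal Z$. Start from $z_0=0$. For $k=1,\dots,K$: * *Inner loop.* Put $w_0=z_{k-1}$ and, for $t=1,\dots,T$, $$w_t=\Pi\big(\kappa\,(w_{t-1}+(\tfrac1\kappa-1)w_0-\eta\,\tilde g_{w_0}(w_{t-1}))\big).$$ Here $\tilde g_{w_0}(z)$ is computed from fresh independent samples $(i,j)\sim p$ and $(i',j')\sim q$, where $$p_{ij}=\frac{\|A_{i:}\|_1^2}{\sum_k\|A_{k:}\|_1^2}\cdot\frac{|A_{ij}|}{\|A_{i:}\|_1},\qquad q_{ij}=\frac{\|A_{:j}\|_1^2}{\sum_k\|A_{:k}\|_1^2}\cdot\frac{|A_{ij}|}{\|A_{:j}\|_1},$$ as $$\tilde g_{w_0}(z)=\Big(\frac{A_{ij}[z^{\mathsf y}-w_0^{\mathsf y}]_i}{p_{ij}}e_j,\ \frac{-A_{i'j'}[z^{\mathsf x}-w_0^{\mathsf x}]_{j'}}{q_{i'j'}}e_{i'}\Big)+g(w_0).$$ Put $z_{k-1/2}=\frac1T\sum_{t=1}^Tw_t$. * *Extragradient step.* Put $z_k=\Pi(z_{k-1}-g(z_{k-1/2})/\alpha)$.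 The output is $\bar z=\frac1K\sum_{k=1}^Kz_{k-1/2}$. **Implementation.** The algorithm is run on a unit-cost real RAM (real arithmetic, square roots, comparisons and memory accesses in one step each) on which the following also take one step: reading an entry of $A$, $b$ or $c$, an $\ell_1$ norm of a row or column of $A$, $m$, $n$, $\mathsf{nnz}$, $\epsilon$, or the position of the $k$-th nonzero entry of $A$; and sampling a row (column) with probability proportional to its squared $\ell_1$ norm, or an entry within a given row (column) with probability proportional to its absolute value. In each inner loop each block of the iterate is kept in an $\mathtt{IterateMaintainer}_2$ initialized with $w_0$ and $v=(1-\kappa)w_0-\eta\kappa g(w_0)$: with scalars and vectors such that the iterate is $\xi_uu+\xi_vv$, the sum of the iterates is $u'+\sigma_uu+\sigma_vv$, and the norm of the iterate, its inner product with $v$, and $\|v\|_2^2$ are stored; thus scaling the iterate, adding a multiple of $v$, adding to one coordinate, adding the iterate to the sum, and reading a coordinate or the norm take $O(1)$ steps each. The parameters are computed by the algorithm. **Theorem.** Every execution of this implementation outputs a point $\bar z\in\mathcal Z$ and takes a number of steps that is at most $$O\Big(\Big(\mathsf{nnz}+\frac{L^2}{\alpha^2}\Big)\frac{\alpha}{\epsilon}\Big)=O\Big(\mathsf{nnz}+\frac{\sqrt{\mathsf{nnz}}\,L}{\epsilon}\Big),$$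 with universal constants, and $$\mathbb E\,\mathrm{Gap}(\bar z)\le\epsilon .$$ Moreover, the value of $\alpha$ above is the optimal one: it minimizes $(\mathsf{nnz}+L^2/\alpha^2)\,\alpha/\epsilon$ over all $\alpha\ge\epsilon$. -/

import Mathlib

/-! ## Bilinear games on a product of two Euclidean unit balls -/

set_option linter.constructorNameAsVariable false

namespace BallGame

/-- `ℝᵏ` with the Euclidean norm. -/
abbrev Vect (k : ℕ) : Type := EuclideanSpace ℝ (Fin k)

/-- The unit Euclidean ball `𝔹ᵏ`. -/
def unitBall (k : ℕ) : Set (Vect k) := Metric.closedBall 0 1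

/-- The bilinear objective `f(x, y) = yᵀ A x + bᵀ x - cᵀ y`. -/
noncomputable def payoff {m n : ℕ} (A : Matrix (Fin m) (Fin n) ℝ) (b : Fin n → ℝ) (c : Fin m → ℝ)
    (x : Vect n) (y : Vect m) : ℝ :=
  (∑ i, ∑ j, y i * A i j * x j) + (∑ j, b j * x j) - ∑ i, c i * y i

/-- The duality gap `max_{y' ∈ 𝔹ᵐ} f(x, y') - min_{x' ∈ 𝔹ⁿ} f(x', y)`. -/
noncomputable def gap {m n : ℕ} (A : Matrix (Fin m) (Fin n) ℝ) (b : Fin n → ℝ) (c : Fin m → ℝ)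
    (z : Vect n × Vect m) : ℝ :=
  (⨆ y' : unitBall m, payoff A b c z.1 y') - ⨅ x' : unitBall n, payoff A b c x' z.2

/-- The number of nonzero entries of `A`. -/
noncomputable def nnz {m n : ℕ} (A : Matrix (Fin m) (Fin n) ℝ) : ℕ :=
  Nat.card {p : Fin m × Fin n // A p.1 p.2 ≠ 0}

/-- `‖A_{i:}‖₁`. -/
noncomputable def rowNorm {m n : ℕ} (A : Matrix (Fin m) (Fin n) ℝ) (i : Fin m) : ℝ := ∑ j, |A i j|

/-- `‖A_{:j}‖₁`. -/
noncomputable def colNorm {m n : ℕ} (A : Matrix (Fin m) (Fin n) ℝ) (j : Fin n) : ℝ := ∑ i, |A i j|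

/-- `L_co^{2,2}`. -/
noncomputable def Lco {m n : ℕ} (A : Matrix (Fin m) (Fin n) ℝ) : ℝ :=
  √((∑ i, rowNorm A i ^ 2) + ∑ j, colNorm A j ^ 2)

/-- An instance of the problem: the matrix, the linear terms, the target accuracy, and the positions
of the nonzero entries of the matrix, listed without repetition in an arbitrary order. -/
structure Game (m n : ℕ) where
  A : Matrix (Fin m) (Fin n) ℝ
  b : Fin n → ℝ
  c : Fin m → ℝ
  eps : ℝ
  nz : Fin (nnz A) ≃ {p : Fin m × Fin n // A p.1 p.2 ≠ 0}

/-! ## A unit-cost randomized real RAM with access to the matrix -/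

/-- The two blocks of variables. -/
inductive Blk
  | x
  | y
  deriving DecidableEq

/-- Scalar real registers. -/
inductive Reg
  | sumRow | sumCol | alpha | eta | kappa | numT | numK | tmp | acc
  | coef (β : Blk)
  | xiU (β : Blk) | xiV (β : Blk) | sigU (β : Blk) | sigV (β : Blk)
  | iota (β : Blk) | nu (β : Blk) | normSqV (β : Blk)
  deriving DecidableEq

/-- Names of the arrays of real memory cells; there is one array of each name for each block. -/
inductive Arr
  | center | grad | half | total | out | u | u' | v
  deriving DecidableEq

/-- Index registers. -/
inductive Idx
  | k | t | l | i | j | ix | jx | iy | jy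
  deriving DecidableEq

/-- Real expressions: constants, registers, memory cells, the basic data of the instance (entries and
`ℓ₁` norms of rows and columns of the matrix, entries of the linear terms, sizes, accuracy), and
arithmetic. -/
inductive RExp
  | lit (k : ℕ)
  | reg (r : Reg)
  | cell (a : Arr) (β : Blk) (i : Idx)
  | entry (i j : Idx)
  | rowL1 (i : Idx)
  | colL1 (j : Idx)
  | bAt (j : Idx)
  | cAt (i : Idx)
  | rows
  | cols
  | numNZ
  | eps
  | add (e f : RExp)
  | sub (e f : RExp)
  | mul (e f : RExp)
  | div (e f : RExp)
  | max (e f : RExp)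
  | sqrt (e : RExp)

instance : Coe Reg RExp := ⟨RExp.reg⟩
instance (k : ℕ) : OfNat RExp k := ⟨RExp.lit k⟩
instance : Add RExp := ⟨RExp.add⟩
instance : Sub RExp := ⟨RExp.sub⟩
instance : Mul RExp := ⟨RExp.mul⟩
instance : Div RExp := ⟨RExp.div⟩

/-- Programs.
* `assign r e`: `r ← e`;
* `store a β i e`: `a_β[i] ← e`;
* `nzPos k i j`: put the position of the `k`-th nonzero entry into `i`, `j`;
* `sampleRow i`: draw a row `i` with probability proportional to `‖A_{i:}‖₁²`;
* `sampleCol j`: draw a column `j` with probability proportional to `‖A_{:j}‖₁²`;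
* `sampleInRow i j`: given `i`, draw `j` with probability `|A_{ij}| / ‖A_{i:}‖₁`;
* `sampleInCol j i`: given `j`, draw `i` with probability `|A_{ij}| / ‖A_{:j}‖₁`;
* `loop l e p`: evaluate `e` once and run `p` for `l = 0, 1, 2, …` as long as `l < e`. -/
inductive Prog
  | assign (r : Reg) (e : RExp)
  | store (a : Arr) (β : Blk) (i : Idx) (e : RExp)
  | nzPos (k i j : Idx)
  | sampleRow (i : Idx)
  | sampleCol (j : Idx)
  | sampleInRow (i j : Idx)
  | sampleInCol (j i : Idx)
  | seq (p q : Prog)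
  | loop (l : Idx) (e : RExp) (p : Prog)

infixr:35 " ⨟ " => Prog.seq

/-- A memory state. -/
structure State where
  reg : Reg → ℝ
  mem : Arr → Blk → ℕ → ℝ
  idx : Idx → ℕ

/-- The blank memory. -/
def State.blank : State := ⟨fun _ => 0, fun _ _ _ => 0, fun _ => 0⟩

def State.setReg (s : State) (r : Reg) (x : ℝ) : State :=
  { s with reg := Function.update s.reg r x }

def State.setCell (s : State) (a : Arr) (β : Blk) (k : ℕ) (x : ℝ) : State :=
  { s with
    mem := Function.update s.mem a
      (Function.update (s.mem a) β (Function.update (s.mem a β) k x)) }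

def State.setIdx (s : State) (l : Idx) (k : ℕ) : State :=
  { s with idx := Function.update s.idx l k }

/-- The `k`-th coordinate of a vector, and `0` if there is none. -/
noncomputable def coord {d : ℕ} (v : Fin d → ℝ) (k : ℕ) : ℝ := if h : k < d then v ⟨k, h⟩ else 0

/-- The value of an expression. -/
noncomputable def RExp.eval {m n : ℕ} (G : Game m n) (s : State) : RExp → ℝ
  | lit k => k
  | reg r => s.reg r
  | cell a β i => s.mem a β (s.idx i)
  | entry i j => coord (fun i' => coord (G.A i') (s.idx j)) (s.idx i)
  | rowL1 i => coord (rowNorm G.A) (s.idx i)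
  | colL1 j => coord (colNorm G.A) (s.idx j)
  | bAt j => coord G.b (s.idx j)
  | cAt i => coord G.c (s.idx i)
  | rows => m
  | cols => n
  | numNZ => nnz G.A
  | eps => G.eps
  | add e f => e.eval G s + f.eval G s
  | sub e f => e.eval G s - f.eval G s
  | mul e f => e.eval G s * f.eval G s
  | div e f => e.eval G s / f.eval G s
  | max e f => Max.max (e.eval G s) (f.eval G s)
  | sqrt e => √(e.eval G s)

/-- The cost of an expression: one step for each constant, access and operation in it. -/
def RExp.cost : RExp → ℕ
  | add e f | sub e f | mul e f | div e f | max e f => e.cost + f.cost + 1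
  | sqrt e => e.cost + 1
  | _ => 1

open Classical in
/-- A random index below `d`, drawn with probability proportional to the weights `w ≥ 0`
(and `0` if all weights vanish). -/
noncomputable def draw {d : ℕ} (w : Fin d → ℝ) : PMF ℕ :=
  if h : (∑' i, ENNReal.ofReal (w i)) ≠ 0 ∧ (∑' i, ENNReal.ofReal (w i)) ≠ ⊤ then
    (PMF.normalize (fun i => ENNReal.ofReal (w i)) h.1 h.2).map Fin.val
  else PMF.pure 0

/-- Execute `f 0, f 1, …, f (N - 1)` one after the other, adding up the costs. -/
noncomputable def iter (f : ℕ → State → PMF (State × ℕ)) : ℕ → State → PMF (State × ℕ)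
  | 0, s => PMF.pure (s, 0)
  | N + 1, s => (iter f N s).bind fun r => (f N r.1).map fun r' => (r'.1, r.2 + r'.2)

/-- The joint law of the final memory and of the number of steps of an execution. -/
noncomputable def Prog.run {m n : ℕ} (G : Game m n) : Prog → State → PMF (State × ℕ)
  | assign r e => fun s => PMF.pure (s.setReg r (e.eval G s), e.cost + 1)
  | store a β i e => fun s => PMF.pure (s.setCell a β (s.idx i) (e.eval G s), e.cost + 1)
  | nzPos k i j => fun s => PMF.pure
      (if h : s.idx k < nnz G.A then
        (s.setIdx i (G.nz ⟨s.idx k, h⟩).1.1).setIdx j (G.nz ⟨s.idx k, h⟩).1.2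
      else s, 1)
  | sampleRow i => fun s => (draw fun i' => rowNorm G.A i' ^ 2).map fun k => (s.setIdx i k, 1)
  | sampleCol j => fun s => (draw fun j' => colNorm G.A j' ^ 2).map fun k => (s.setIdx j k, 1)
  | sampleInRow i j => fun s =>
      (draw fun j' : Fin n => coord (fun i' => |G.A i' j'|) (s.idx i)).map fun k => (s.setIdx j k, 1)
  | sampleInCol j i => fun s =>
      (draw fun i' : Fin m => coord (fun j' => |G.A i' j'|) (s.idx j)).map fun k => (s.setIdx i k, 1)
  | seq p q => fun s =>
      (p.run G s).bind fun r => (q.run G r.1).map fun r' => (r'.1, r.2 + r'.2)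
  | loop l e p => fun s =>
      (iter (fun k s' => (p.run G (s'.setIdx l k)).map fun r => (r.1, r.2 + 1))
        ⌈e.eval G s⌉₊ s).map fun r => (r.1, r.2 + e.cost + 1)

/-! ## The data structure `IterateMaintainer₂` (without sampling)

It represents the iterate as `x = ξ_u u + ξ_v v`, the running sum as `s = u' + σ_u u + σ_v v`, and keeps
`ι = ⟨x, v⟩`, `ν = ‖x‖₂` and `‖v‖₂²`. -/

section

open Reg RExp Prog

/-- The dimension of a block. -/
def dim : Blk → RExp
  | .x => cols
  | .y => rows

/-- `Init(x₀, v)`, where the coordinate `l` of `v` is given by the expression `e`. -/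
def imInit (β : Blk) (x₀ : Arr) (e : RExp) : Prog :=
  assign (normSqV β) 0 ⨟ assign (iota β) 0 ⨟ assign (nu β) 0 ⨟
  loop .l (dim β)
    (store .u β .l (cell x₀ β .l) ⨟
     store .u' β .l 0 ⨟
     store .v β .l e ⨟
     assign (normSqV β) (normSqV β + cell .v β .l * cell .v β .l) ⨟
     assign (iota β) (iota β + cell .u β .l * cell .v β .l) ⨟
     assign (nu β) (nu β + cell .u β .l * cell .u β .l)) ⨟
  assign (nu β) (sqrt (nu β)) ⨟
  assign (xiU β) 1 ⨟ assign (xiV β) 0 ⨟ assign (sigU β) 0 ⨟ assign (sigV β) 0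

/-- `Get(j)`. -/
def imGet (β : Blk) (j : Idx) : RExp := xiU β * cell .u β j + xiV β * cell .v β j

/-- `GetSum(j)`. -/
def imGetSum (β : Blk) (j : Idx) : RExp :=
  cell .u' β j + sigU β * cell .u β j + sigV β * cell .v β j

/-- `GetNorm()`. -/
def imGetNorm (β : Blk) : RExp := nu β

/-- `Scale(e)`. -/
def imScale (β : Blk) (e : RExp) : Prog :=
  assign tmp e ⨟
  assign (xiU β) (xiU β * tmp) ⨟ assign (xiV β) (xiV β * tmp) ⨟
  assign (nu β) (nu β * tmp) ⨟ assign (iota β) (iota β * tmp)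

/-- `AddDense(e)`. -/
def imAddDense (β : Blk) (e : RExp) : Prog :=
  assign tmp e ⨟
  assign (nu β) (sqrt (nu β * nu β + 2 * tmp * iota β + tmp * tmp * normSqV β)) ⨟
  assign (iota β) (iota β + tmp * normSqV β) ⨟
  assign (xiV β) (xiV β + tmp)

/-- `AddSparse(j, e)`. -/
def imAddSparse (β : Blk) (j : Idx) (e : RExp) : Prog :=
  assign tmp e ⨟
  assign (nu β) (sqrt (nu β * nu β + 2 * tmp * imGet β j + tmp * tmp)) ⨟
  assign (iota β) (iota β + tmp * cell .v β j) ⨟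
  store .u' β j (cell .u' β j - tmp * sigU β / xiU β) ⨟
  store .u β j (cell .u β j + tmp / xiU β)

/-- `UpdateSum()`. -/
def imUpdateSum (β : Blk) : Prog :=
  assign (sigU β) (sigU β + xiU β) ⨟ assign (sigV β) (sigV β + xiV β)

/-! ## The variance-reduced coordinate method -/

/-- `grad ← g(z) = (Aᵀ zʸ + b, -A zˣ + c)` for the point `z` stored in the arrays `a`. -/
def gradientOf (a : Arr) : Prog :=
  loop .l cols (store .grad .x .l (bAt .l)) ⨟
  loop .l rows (store .grad .y .l (cAt .l)) ⨟
  loop .l numNZ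
    (nzPos .l .i .j ⨟
     store .grad .x .j (cell .grad .x .j + entry .i .j * cell a .y .i) ⨟
     store .grad .y .i (cell .grad .y .i - entry .i .j * cell a .x .j))

/-- `|A_{ij}|`. -/
def absEntry (i j : Idx) : RExp := RExp.max (entry i j) (0 - entry i j)

/-- `p_{ij} = (‖A_{i:}‖₁² / ∑ₖ ‖A_{k:}‖₁²) · (|A_{ij}| / ‖A_{i:}‖₁)`. -/
def probP (i j : Idx) : RExp := rowL1 i * rowL1 i / sumRow * (absEntry i j / rowL1 i)

/-- `q_{ij} = (‖A_{:j}‖₁² / ∑ₖ ‖A_{:k}‖₁²) · (|A_{ij}| / ‖A_{:j}‖₁)`. -/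
def probQ (i j : Idx) : RExp := colL1 j * colL1 j / sumCol * (absEntry i j / colL1 j)

/-- Draw `(iˣ, jˣ) ∼ p` and `(iʸ, jʸ) ∼ q`, and compute the coordinate `jˣ` of the `x` block and the
coordinate `iʸ` of the `y` block of `g̃_{w₀}(w) - g(w₀)` at the current inner iterate `w`; all its other
coordinates vanish. -/
def sampleEstimator : Prog :=
  sampleRow .ix ⨟ sampleInRow .ix .jx ⨟
  sampleCol .jy ⨟ sampleInCol .jy .iy ⨟
  assign (coef .x)
    (entry .ix .jx * (imGet .y .ix - cell .center .y .ix) / probP .ix .jx) ⨟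
  assign (coef .y)
    (0 - entry .iy .jy * (imGet .x .jy - cell .center .x .jy) / probQ .iy .jy)

/-- The mirror descent step
`w ← Π(κ (w + (1 / κ - 1) w₀ - η g̃_{w₀}(w)))` in one block, followed by the update of the running sum. -/
def updateBlock (β : Blk) (j : Idx) : Prog :=
  imScale β kappa ⨟
  imAddDense β 1 ⨟
  imAddSparse β j (0 - kappa * eta * coef β) ⨟
  imScale β (1 / RExp.max (imGetNorm β) 1) ⨟
  imUpdateSum β

/-- The inner loop, with reference point `w₀ = center` and `v = (1 - κ) w₀ - η κ g(w₀)`; the average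
iterate is written to `half`. -/
def innerLoop : Prog :=
  gradientOf .center ⨟
  imInit .x .center ((1 - kappa) * cell .center .x .l - eta * kappa * cell .grad .x .l) ⨟
  imInit .y .center ((1 - kappa) * cell .center .y .l - eta * kappa * cell .grad .y .l) ⨟
  loop .t numT (sampleEstimator ⨟ updateBlock .x .jx ⨟ updateBlock .y .iy) ⨟
  loop .l cols (store .half .x .l (imGetSum .x .l / numT)) ⨟
  loop .l rows (store .half .y .l (imGetSum .y .l / numT))

/-- The extragradient step `z_k = Π(z_{k-1} - g(z_{k-1/2}) / α)` in one block, where `center` stores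
`z_{k-1}` and `grad` stores `g(z_{k-1/2})`; also `total ← total + z_{k-1/2}`. -/
def extragradient (β : Blk) : Prog :=
  assign acc 0 ⨟
  loop .l (dim β)
    (store .total β .l (cell .total β .l + cell .half β .l) ⨟
     store .center β .l (cell .center β .l - cell .grad β .l / alpha) ⨟
     assign acc (acc + cell .center β .l * cell .center β .l)) ⨟
  assign acc (RExp.max 1 (sqrt acc)) ⨟
  loop .l (dim β) (store .center β .l (cell .center β .l / acc))

/-- The parameters `α = max {ε, L_co √(1 / nnz)}`, `η = α / (20 L_co²)`, `κ = 1 / (1 + η α / 2)`,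
`T = ⌈6 / (η α)⌉` and `K = ⌈α Θ / ε⌉` with `Θ = 1`. -/
def parameters : Prog :=
  assign sumRow 0 ⨟ assign sumCol 0 ⨟
  loop .l rows (assign sumRow (sumRow + rowL1 .l * rowL1 .l)) ⨟
  loop .l cols (assign sumCol (sumCol + colL1 .l * colL1 .l)) ⨟
  assign alpha (RExp.max eps (sqrt (sumRow + sumCol) * sqrt (1 / numNZ))) ⨟
  assign eta (alpha / (20 * (sumRow + sumCol))) ⨟
  assign kappa (1 / (1 + eta * alpha / 2)) ⨟
  assign numT 0 ⨟ loop .l (6 / (eta * alpha)) (assign numT (numT + 1)) ⨟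
  assign numK 0 ⨟ loop .l (alpha / eps) (assign numK (numK + 1))

/-- Write the constant `0` to `a_β`. -/
def clear (a : Arr) (β : Blk) : Prog := loop .l (dim β) (store a β .l 0)

/-- The variance-reduced coordinate method: the outer loop starts at `z₀ = 0`, and the output
`z̄ = (1 / K) ∑ₖ z_{k-1/2}` is written to `out`. -/
def vrCoordinateMethod : Prog :=
  parameters ⨟
  clear .center .x ⨟ clear .center .y ⨟ clear .total .x ⨟ clear .total .y ⨟
  loop .k numK
    (innerLoop ⨟ gradientOf .half ⨟ extragradient .x ⨟ extragradient .y) ⨟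
  loop .l cols (store .out .x .l (cell .total .x .l / numK)) ⨟
  loop .l rows (store .out .y .l (cell .total .y .l / numK))

end

/-- The joint law of the final memory and of the running time of the method. -/
noncomputable def execution {m n : ℕ} (G : Game m n) : PMF (State × ℕ) :=
  vrCoordinateMethod.run G State.blank

/-- The point `z̄` stored in `out`. -/
noncomputable def State.output (s : State) (m n : ℕ) : Vect n × Vect m :=
  (WithLp.toLp 2 fun j => s.mem .out .x j, WithLp.toLp 2 fun i => s.mem .out .y i)

/-- The parameter `α = max {ε, L_co √(1 / nnz)}`. -/
noncomputable def alphaOpt {m n : ℕ} (A : Matrix (Fin m) (Fin n) ℝ) (ε : ℝ) : ℝ :=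
  max ε (Lco A * √(1 / nnz A))

/-- The bound `(nnz + L_co² / α²) · α / ε`. -/
noncomputable def timeBound {m n : ℕ} (A : Matrix (Fin m) (Fin n) ℝ) (ε α : ℝ) : ℝ :=
  (nnz A + Lco A ^ 2 / α ^ 2) * (α / ε)

end BallGame

set_option linter.constructorNameAsVariable false

namespace BallGame

open scoped RealInnerProductSpace

/-! Write g(z) = M z + h with M skew (`skewMap`), and V_z(u) = ‖u − z‖²/2. Because f is affine in
each block, ⟨g(p), p − u⟩ equals f(pˣ, uʸ) − f(uˣ, pʸ), so a bound on it over all u in the product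
of the balls bounds the duality gap at p (`gap_le`). Accuracy is therefore a regret estimate, and by
skewness regret is affine in the queried point, so it passes to averages without loss.

Inner loop. The projection inequality gives a one-step bound (`proximal_step`), and its sum is
`RegretBound`. The comparator u may depend on the samples, so the noise term ⟨N, z − u⟩ cannot
simply be averaged away, where N is the accumulated error of the estimator. Young's inequality
replaces it by η²‖N‖²/2 + V_z(u) (`RegretBound.final`); the choice T ≥ 6/(ηα) makes the V_z(u) terms
fit into ηTα V_z(u). What remains is the potential R + η²‖N‖²/2, which no longer involves u. It is a
supermartingale (`InnerInv.mean_potential_le`): the estimator is unbiased, its second moment is at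
most L²‖w − z‖² (`sum_importance`, `mean_sampleEstimator`), and ηL² = α/20 makes the regularization
term −(ηα/4)‖w − z‖² dominate. Hence the average iterate p satisfies E sup_u (⟨g(p), p − u⟩ − α
V_z(u)) ≤ 0 (`mean_innerLoop_le`).

Outer loop. `extragradient_step` bounds the regret at p by α(V_z(u) − V_{z'}(u)), which telescopes,
plus ⟨g(p), p − z'⟩ − α V_z(z'). The latter is the inner guarantee at u = z', and its mean is
nonpositive although z' is random, because the supremum stands inside the expectation. As V_0(u) ≤ 1
on the product of two unit balls, the expected gap is at most α/K ≤ ε (`OuterInv.gap_le`,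
`mean_gap_le`).

Program. `Spec` carries what holds in every execution, including the step count, and `Prog.mean`
carries expectations. Regret, noise and iterates occur as ghost variables attached to machine
states, and `Maintains` links the registers to the vectors they encode. Every random choice is from
a finite set, so all expectations are finite sums. The count is O((K + 1)(m + n + nnz + T + 1)), and
m, n ≤ nnz because no row or column vanishes (`cost_le_timeBound`). -/

/-! ## Expectations of finitely supported laws -/

/-- The expectation of `f` under `p`. -/
noncomputable def expect {α : Type*} (p : PMF α) (f : α → ℝ) : ℝ := ∑' a, (p a).toReal * f a

section expect

variable {α γ : Type*}

theorem hasFiniteSupport_expect {p : PMF α} (hp : p.support.Finite) (f : α → ℝ) :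
    (Function.support fun a => (p a).toReal * f a) ⊆ hp.toFinset := by
  intro a ha
  simp only [Function.mem_support, ne_eq, mul_eq_zero, not_or] at ha
  simp only [Set.Finite.coe_toFinset, PMF.mem_support_iff]
  rintro h
  simp [h] at ha

theorem summable_expect {p : PMF α} (hp : p.support.Finite) (f : α → ℝ) :
    Summable fun a => (p a).toReal * f a :=
  summable_of_hasFiniteSupport ((Finset.finite_toSet _).subset (hasFiniteSupport_expect hp f))

theorem expect_eq_sum {p : PMF α} {F : Finset α} (hF : p.support ⊆ F) (f : α → ℝ) :
    expect p f = ∑ a ∈ F, (p a).toReal * f a := by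
  refine tsum_eq_sum fun a ha => ?_
  have : p a = 0 := by
    by_contra h
    exact ha (hF ((PMF.mem_support_iff _ _).2 h))
  simp [this]

theorem expect_pure (a : α) (f : α → ℝ) : expect (PMF.pure a) f = f a := by
  rw [expect_eq_sum (F := {a}) (by simp [PMF.support_pure])]
  simp

theorem expect_const {p : PMF α} (hp : p.support.Finite) (B : ℝ) : expect p (fun _ => B) = B := by
  rw [expect_eq_sum (F := hp.toFinset) (by simp), ← Finset.sum_mul]
  have : (∑ a ∈ hp.toFinset, (p a).toReal) = 1 := by
    rw [← ENNReal.toReal_sum fun a _ => p.apply_ne_top a]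
    have h := p.tsum_coe
    rw [tsum_eq_sum (s := hp.toFinset)] at h
    · simp [h]
    · intro a ha
      simpa [PMF.mem_support_iff] using ha
  simp [this]

theorem expect_mono {p : PMF α} (hp : p.support.Finite) {f f' : α → ℝ}
    (h : ∀ a ∈ p.support, f a ≤ f' a) : expect p f ≤ expect p f' := by
  rw [expect_eq_sum (F := hp.toFinset) (by simp), expect_eq_sum (F := hp.toFinset) (by simp)]
  refine Finset.sum_le_sum fun a ha => mul_le_mul_of_nonneg_left (h a ?_) ENNReal.toReal_nonneg
  simpa using ha

theorem expect_le {p : PMF α} (hp : p.support.Finite) {f : α → ℝ} {B : ℝ}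
    (h : ∀ a ∈ p.support, f a ≤ B) : expect p f ≤ B :=
  (expect_mono hp h).trans_eq (expect_const hp B)

theorem support_bind_finite {p : PMF α} {q : α → PMF γ} (hp : p.support.Finite)
    (hq : ∀ a ∈ p.support, (q a).support.Finite) : (p.bind q).support.Finite := by
  rw [PMF.support_bind]
  exact hp.biUnion hq

theorem support_map_finite {p : PMF α} (q : α → γ) (hp : p.support.Finite) :
    (p.map q).support.Finite := by
  rw [PMF.support_map]
  exact hp.image _

/-- The tower property. Finite supports reduce it to exchanging two finite sums, once every inner
sum is extended to the support of the whole law. -/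
theorem expect_bind {p : PMF α} {q : α → PMF γ} (hp : p.support.Finite)
    (hq : ∀ a ∈ p.support, (q a).support.Finite) (f : γ → ℝ) :
    expect (p.bind q) f = expect p fun a => expect (q a) f := by
  have hb := support_bind_finite hp hq
  rw [expect_eq_sum (F := hb.toFinset) (by simp), expect_eq_sum (F := hp.toFinset) (by simp)]
  have h1 : ∀ a ∈ hp.toFinset, (p a).toReal * expect (q a) f =
      ∑ c ∈ hb.toFinset, (p a).toReal * ((q a c).toReal * f c) := by
    intro a ha
    rw [expect_eq_sum (F := hb.toFinset), Finset.mul_sum]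
    intro c hc
    simp only [Set.Finite.coe_toFinset, PMF.mem_support_bind_iff]
    exact ⟨a, by simpa using ha, hc⟩
  rw [Finset.sum_congr rfl h1, Finset.sum_comm]
  refine Finset.sum_congr rfl fun c _ => ?_
  rw [PMF.bind_apply, tsum_eq_sum (s := hp.toFinset), ENNReal.toReal_sum, Finset.sum_mul]
  · simp [mul_assoc]
  · intro a _
    exact ENNReal.mul_ne_top (p.apply_ne_top a) ((q a).apply_ne_top c)
  · intro a ha
    have : p a = 0 := by simpa [PMF.mem_support_iff] using ha
    simp [this]

theorem expect_map {p : PMF α} (q : α → γ) (hp : p.support.Finite) (f : γ → ℝ) :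
    expect (p.map q) f = expect p fun a => f (q a) := by
  rw [← PMF.bind_pure_comp, expect_bind hp]
  · simp [expect_pure]
  · simp [PMF.support_pure]

end expect

/-! ## Sampling an index -/

theorem draw_support_finite {d : ℕ} (w : Fin d → ℝ) : (draw w).support.Finite := by
  unfold draw
  split_ifs
  · exact support_map_finite _ (Set.toFinite _)
  · simp [PMF.support_pure]

/-- Positive total weight excludes the default branch of `draw`, so the law is a genuine one on `Fin
d`, with real probabilities to calculate with. -/
theorem draw_eq_map {d : ℕ} {w : Fin d → ℝ} (hw : ∀ i, 0 ≤ w i) (hs : 0 < ∑ i, w i) :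
    ∃ p : PMF (Fin d), draw w = p.map Fin.val ∧ ∀ i, (p i).toReal = w i / ∑ k, w k := by
  have h : (∑' i, ENNReal.ofReal (w i)) = ENNReal.ofReal (∑ i, w i) := by
    rw [tsum_fintype, ENNReal.ofReal_sum_of_nonneg fun i _ => hw i]
  have h' : (∑' i, ENNReal.ofReal (w i)) ≠ 0 ∧ (∑' i, ENNReal.ofReal (w i)) ≠ ⊤ := by
    rw [h]
    simpa using hs
  refine ⟨PMF.normalize (fun i => ENNReal.ofReal (w i)) h'.1 h'.2, ?_, fun i => ?_⟩
  · rw [draw, dif_pos h']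
  · rw [PMF.normalize_apply, h, ENNReal.toReal_mul, ENNReal.toReal_inv,
      ENNReal.toReal_ofReal (hw i), ENNReal.toReal_ofReal hs.le, div_eq_mul_inv]

theorem expect_draw {d : ℕ} {w : Fin d → ℝ} (hw : ∀ i, 0 ≤ w i) (hs : 0 < ∑ i, w i) (f : ℕ → ℝ) :
    expect (draw w) f = ∑ i, w i / (∑ k, w k) * f i := by
  obtain ⟨p, hp, hpi⟩ := draw_eq_map hw hs
  rw [hp, expect_map _ (Set.toFinite _), expect_eq_sum (F := Finset.univ) (by simp)]
  simp [hpi]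

theorem exists_of_mem_support_draw {d : ℕ} {w : Fin d → ℝ} (hw : ∀ i, 0 ≤ w i)
    (hs : 0 < ∑ i, w i) {k : ℕ} (hk : k ∈ (draw w).support) : ∃ i : Fin d, (i : ℕ) = k ∧ w i ≠ 0 := by
  obtain ⟨p, hp, hpi⟩ := draw_eq_map hw hs
  rw [hp, PMF.support_map] at hk
  obtain ⟨i, hi, rfl⟩ := hk
  refine ⟨i, rfl, fun h => (PMF.mem_support_iff _ _).1 hi ?_⟩
  have := hpi i
  rw [h, zero_div, ENNReal.toReal_eq_zero_iff] at this
  exact this.resolve_right (p.apply_ne_top i)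

/-! ## Program logic -/

section logic

variable {m n : ℕ} {G : Game m n}

theorem iter_support_finite {f : ℕ → State → PMF (State × ℕ)}
    (hf : ∀ k s, (f k s).support.Finite) (N : ℕ) (s : State) : (iter f N s).support.Finite := by
  induction N with
  | zero => simp [iter, PMF.support_pure]
  | succ N ih => exact support_bind_finite ih fun r _ => support_map_finite _ (hf _ _)

theorem run_support_finite (G : Game m n) (p : Prog) (s : State) : (p.run G s).support.Finite := by
  induction p generalizing s with
  | assign | store | nzPos => simp [Prog.run, PMF.support_pure]
  | sampleRow | sampleCol | sampleInRow | sampleInCol =>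
    exact support_map_finite _ (draw_support_finite _)
  | seq p q hp hq => exact support_bind_finite (hp s) fun r _ => support_map_finite _ (hq _)
  | loop l e p hp =>
    exact support_map_finite _ (iter_support_finite (fun k s => support_map_finite _ (hp _)) _ _)

/-- Every execution of `p` from `s` takes at most `c` steps and ends in a state satisfying `Q`. -/
def Spec (G : Game m n) (p : Prog) (s : State) (c : ℕ) (Q : State → Prop) : Prop :=
  ∀ r ∈ (p.run G s).support, r.2 ≤ c ∧ Q r.1

/-- The expectation of `F` at the end of `p`, started from `s`. -/
noncomputable def Prog.mean (G : Game m n) (p : Prog) (s : State) (F : State → ℝ) : ℝ :=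
  expect (p.run G s) fun r => F r.1

theorem Spec.mono {p : Prog} {s : State} {c c' : ℕ} {Q Q' : State → Prop} (h : Spec G p s c Q)
    (hc : c ≤ c') (hQ : ∀ s', Q s' → Q' s') : Spec G p s c' Q' :=
  fun r hr => ⟨(h r hr).1.trans hc, hQ _ (h r hr).2⟩

theorem Spec.assign {r : Reg} {e : RExp} {s : State} {Q : State → Prop}
    (h : Q (s.setReg r (e.eval G s))) : Spec G (Prog.assign r e) s (e.cost + 1) Q := by
  intro r hr
  simp only [Prog.run, PMF.support_pure, Set.mem_singleton_iff] at hr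
  subst hr
  exact ⟨le_rfl, h⟩

theorem Spec.store {a : Arr} {β : Blk} {i : Idx} {e : RExp} {s : State} {Q : State → Prop}
    (h : Q (s.setCell a β (s.idx i) (e.eval G s))) :
    Spec G (Prog.store a β i e) s (e.cost + 1) Q := by
  intro r hr
  simp only [Prog.run, PMF.support_pure, Set.mem_singleton_iff] at hr
  subst hr
  exact ⟨le_rfl, h⟩

theorem Spec.nzPos {k i j : Idx} {s : State} {Q : State → Prop} (hk : s.idx k < nnz G.A)
    (h : Q ((s.setIdx i (G.nz ⟨s.idx k, hk⟩).1.1).setIdx j (G.nz ⟨s.idx k, hk⟩).1.2)) :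
    Spec G (Prog.nzPos k i j) s 1 Q := by
  intro r hr
  simp only [Prog.run, PMF.support_pure, Set.mem_singleton_iff, dif_pos hk] at hr
  subst hr
  exact ⟨le_rfl, h⟩

theorem Spec.seq {p q : Prog} {s : State} {c₁ c₂ : ℕ} {P Q : State → Prop}
    (hp : Spec G p s c₁ P) (hq : ∀ s', P s' → Spec G q s' c₂ Q) :
    Spec G (p ⨟ q) s (c₁ + c₂) Q := by
  intro r hr
  simp only [Prog.run, PMF.mem_support_bind_iff, PMF.mem_support_map_iff] at hr
  obtain ⟨r₁, h₁, r₂, h₂, rfl⟩ := hr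
  obtain ⟨hc₁, hP⟩ := hp _ h₁
  obtain ⟨hc₂, hQ⟩ := hq _ hP _ h₂
  exact ⟨Nat.add_le_add hc₁ hc₂, hQ⟩

theorem iter_spec {f : ℕ → State → PMF (State × ℕ)} {N c : ℕ} {I : ℕ → State → Prop} {s : State}
    (h₀ : I 0 s) (h : ∀ k < N, ∀ s', I k s' → ∀ r ∈ (f k s').support, r.2 ≤ c ∧ I (k + 1) r.1) :
    ∀ r ∈ (iter f N s).support, r.2 ≤ N * c ∧ I N r.1 := by
  induction N with
  | zero =>
    intro r hr
    simp only [iter, PMF.support_pure, Set.mem_singleton_iff] at hr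
    subst hr
    exact ⟨by simp, h₀⟩
  | succ N ih =>
    intro r hr
    simp only [iter, PMF.mem_support_bind_iff, PMF.mem_support_map_iff] at hr
    obtain ⟨r₁, h₁, r₂, h₂, rfl⟩ := hr
    obtain ⟨hc₁, hI⟩ := ih (fun k hk => h k (hk.trans (Nat.lt_succ_self N))) _ h₁
    obtain ⟨hc₂, hI'⟩ := h N (Nat.lt_succ_self N) _ hI _ h₂
    refine ⟨?_, hI'⟩
    rw [Nat.succ_mul]
    exact Nat.add_le_add hc₁ hc₂

/-- The loop bound is evaluated once, in the initial state, so the number of rounds is fixed even if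
the body changes the registers occurring in `e`. Each round pays one extra step for the counter. -/
theorem Spec.loop {l : Idx} {e : RExp} {p : Prog} {s : State} {N c : ℕ} (I : ℕ → State → Prop)
    (hN : ⌈e.eval G s⌉₊ = N) (h₀ : I 0 s)
    (h : ∀ k < N, ∀ s', I k s' → Spec G p (s'.setIdx l k) c (I (k + 1))) :
    Spec G (Prog.loop l e p) s (N * (c + 1) + e.cost + 1) (I N) := by
  intro r hr
  simp only [Prog.run, PMF.mem_support_map_iff, hN] at hr
  obtain ⟨r₁, h₁, rfl⟩ := hr
  obtain ⟨hc, hI⟩ := iter_spec (c := c + 1) h₀ (fun k hk s' hs' r hr => by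
    simp only [PMF.mem_support_map_iff] at hr
    obtain ⟨r₂, h₂, rfl⟩ := hr
    obtain ⟨hc, hI⟩ := h k hk s' hs' _ h₂
    exact ⟨Nat.add_le_add_right hc 1, hI⟩) _ h₁
  exact ⟨by simp only; omega, hI⟩

theorem Prog.mean_le {p : Prog} {s : State} {c : ℕ} {Q : State → Prop} (h : Spec G p s c Q)
    {F : State → ℝ} {B : ℝ} (hF : ∀ s', Q s' → F s' ≤ B) : p.mean G s F ≤ B :=
  expect_le (run_support_finite G p s) fun r hr => hF _ (h r hr).2

theorem Prog.mean_mono {p : Prog} {s : State} {c : ℕ} {Q : State → Prop} (h : Spec G p s c Q)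
    {F F' : State → ℝ} (hF : ∀ s', Q s' → F s' ≤ F' s') : p.mean G s F ≤ p.mean G s F' :=
  expect_mono (run_support_finite G p s) fun r hr => hF _ (h r hr).2

theorem Prog.mean_const_add_mul (p : Prog) (s : State) (F : State → ℝ) (a c : ℝ) :
    p.mean G s (fun s' => a + c * F s') = a + c * p.mean G s F := by
  have hp := run_support_finite G p s
  have h := expect_const hp a
  rw [Prog.mean, Prog.mean, expect_eq_sum (F := hp.toFinset) (by simp),
    expect_eq_sum (F := hp.toFinset) (by simp), Finset.mul_sum]
  rw [expect_eq_sum (F := hp.toFinset) (by simp)] at h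
  nth_rewrite 2 [← h]
  rw [← Finset.sum_add_distrib]
  exact Finset.sum_congr rfl fun _ _ => by ring

theorem Prog.mean_seq (p q : Prog) (s : State) (F : State → ℝ) :
    (p ⨟ q).mean G s F = p.mean G s fun s' => q.mean G s' F := by
  simp only [Prog.mean, Prog.run]
  rw [expect_bind (run_support_finite G p s)
    fun r _ => support_map_finite _ (run_support_finite G q _)]
  simp only [expect_map _ (run_support_finite G q _)]

theorem Prog.mean_assign (r : Reg) (e : RExp) (s : State) (F : State → ℝ) :
    (Prog.assign r e).mean G s F = F (s.setReg r (e.eval G s)) := by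
  simp [Prog.mean, Prog.run, expect_pure]

/-- Induction that peels off the last round: `F` is replaced by its conditional expectation given
the earlier rounds, which satisfies the same hypothesis one round earlier. The new ghost value may
depend on the state reached, hence on the randomness of the round. -/
theorem expect_iter_le {Γ : Type*} {f : ℕ → State → PMF (State × ℕ)}
    (hf : ∀ k s, (f k s).support.Finite) {N : ℕ} {I : ℕ → State → Γ → Prop} {Φ : Γ → ℝ}
    {F : State → ℝ} {s : State} {γ : Γ} (h₀ : I 0 s γ)
    (h : ∀ k < N, ∀ s γ, I k s γ → ∃ γ' : State → Γ,
      (∀ r ∈ (f k s).support, I (k + 1) r.1 (γ' r.1)) ∧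
      expect (f k s) (fun r => Φ (γ' r.1)) ≤ Φ γ)
    (hF : ∀ s γ, I N s γ → F s ≤ Φ γ) :
    expect (iter f N s) (fun r => F r.1) ≤ Φ γ := by
  induction N generalizing F with
  | zero =>
    rw [iter, expect_pure]
    exact hF _ _ h₀
  | succ N ih =>
    rw [iter, expect_bind (iter_support_finite hf N s) fun r _ => support_map_finite _ (hf _ _)]
    simp only [expect_map _ (hf _ _)]
    refine ih (F := fun s => expect (f N s) fun r => F r.1)
      (fun k hk => h k (hk.trans (Nat.lt_succ_self N))) fun s γ hs => ?_
    obtain ⟨γ', hI, hle⟩ := h N (Nat.lt_succ_self N) s γ hs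
    exact (expect_mono (hf N s) fun r hr => hF _ _ (hI r hr)).trans hle

/-- A loop with a ghost variable: the potential `Φ` of the ghost variable is a supermartingale. -/
theorem Prog.mean_loop_le {Γ : Type*} {l : Idx} {e : RExp} {p : Prog} {s : State} {N : ℕ}
    (I : ℕ → State → Γ → Prop) (Φ : Γ → ℝ) {F : State → ℝ} {γ : Γ}
    (hN : ⌈e.eval G s⌉₊ = N) (h₀ : I 0 s γ)
    (h : ∀ k < N, ∀ s γ, I k s γ → ∃ γ' : State → Γ,
      (∃ c, Spec G p (s.setIdx l k) c fun s' => I (k + 1) s' (γ' s')) ∧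
      p.mean G (s.setIdx l k) (fun s' => Φ (γ' s')) ≤ Φ γ)
    (hF : ∀ s γ, I N s γ → F s ≤ Φ γ) :
    (Prog.loop l e p).mean G s F ≤ Φ γ := by
  have hf : ∀ k (s' : State), ((p.run G (s'.setIdx l k)).map fun r => (r.1, r.2 + 1)).support.Finite :=
    fun k (s' : State) => support_map_finite _ (run_support_finite G p (s'.setIdx l k))
  simp only [Prog.mean, Prog.run, hN]
  rw [expect_map _ (iter_support_finite hf _ _)]
  refine expect_iter_le hf h₀ (fun k hk s γ hs => ?_) hF
  obtain ⟨γ', ⟨c, hI⟩, hle⟩ := h k hk s γ hs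
  refine ⟨γ', fun r hr => ?_, ?_⟩
  · rw [PMF.mem_support_map_iff] at hr
    obtain ⟨r₂, h₂, rfl⟩ := hr
    exact (hI _ h₂).2
  · rwa [expect_map _ (run_support_finite G p _)]

end logic

/-! ## Regret bounds in an inner product space -/

section regret

variable {E : Type*} [NormedAddCommGroup E] [InnerProductSpace ℝ E]

/-- One regularized mirror descent step from `w` to `w'` with reference point `z` and gradient
`g + δ`, where `w'` is the projection of `κ w + ((1 - κ) z - η κ g) - κ η δ` onto `Z`. -/
theorem proximal_step {Z : Set E} {η α : ℝ} (hη : 0 ≤ η) (hα : 0 ≤ α) {w w' z g δ : E}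
    {κ : ℝ} (hκ : κ = 1 / (1 + η * α / 2))
    (h : ∀ u ∈ Z, ⟪κ • w + ((1 - κ) • z - (η * κ) • g) - (κ * η) • δ - w', u - w'⟫ ≤ 0)
    {u : E} (hu : u ∈ Z) :
    η * ⟪g, w' - u⟫ ≤ ‖u - w‖ ^ 2 / 2 - ‖u - w'‖ ^ 2 / 2
      + η * α / 2 * (‖u - z‖ ^ 2 / 2 - ‖w' - z‖ ^ 2 / 2)
      + η ^ 2 / 2 * ‖δ‖ ^ 2 - η * ⟪δ, w - z⟫ - η * ⟪δ, z - u⟫ := by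
  have hc : 0 ≤ η * α / 2 := by positivity
  have hκ' : (1 + η * α / 2) * κ = 1 := by rw [hκ]; field_simp
  set ρ := η * α / 2 with hρ
  -- Multiplication by 1 + ρ = 1/κ undoes the shrinkage and yields the optimality condition of the
  -- regularized step.
  have h1 : ⟪w + ρ • z - η • g - η • δ - (1 + ρ) • w', u - w'⟫ ≤ 0 := by
    have h2 := mul_nonpos_of_nonneg_of_nonpos (by positivity : 0 ≤ 1 + ρ) (h u hu)
    rw [← real_inner_smul_left] at h2
    have e : (1 + ρ) • (κ • w + ((1 - κ) • z - (η * κ) • g) - (κ * η) • δ - w') =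
        w + ρ • z - η • g - η • δ - (1 + ρ) • w' := by
      have e1 : (1 + ρ) * (1 - κ) = ρ := by linarith
      have e2 : (1 + ρ) * (η * κ) = η := by linear_combination η * hκ'
      have e3 : (1 + ρ) * (κ * η) = η := by linear_combination η * hκ'
      simp only [smul_sub, smul_add, smul_smul, e1, e2, e3, hκ', one_smul]
      abel
    rwa [e] at h2
  -- Young's inequality in disguise: −η⟨δ, w' − w⟩ − ‖w' − w‖²/2 ≤ η²‖δ‖²/2.
  have h2 : 0 ≤ ‖η • δ + (w' - w)‖ ^ 2 := sq_nonneg _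
  -- The regularizer also produces −ρ‖u − w'‖²/2, which is discarded.
  have h3 : 0 ≤ ρ * ‖u - w'‖ ^ 2 := by positivity
  simp only [inner_sub_left, inner_sub_right, inner_add_left, real_inner_smul_left,
    norm_add_sq_real, norm_sub_sq_real, norm_smul, real_inner_self_eq_norm_sq,
    mul_pow, Real.norm_eq_abs, sq_abs, real_inner_comm w u, real_inner_comm w' u,
    real_inner_comm z u, real_inner_comm w w', real_inner_comm z w'] at h1 h2 h3 ⊢
  linarith

/-- The regret bound that holds after `t` steps of the inner loop, with reference point `z`, gradient
`g` at `z`, iterate `w` and sum of the iterates `S`; `N` is the sum of the errors of the estimator and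
`R` collects the terms that do not depend on the comparator. -/
def RegretBound (Z : Set E) (M : E →ₗ[ℝ] E) (η α : ℝ) (z g : E) (t : ℕ) (w S N : E) (R : ℝ) : Prop :=
  ∀ u ∈ Z, η * (⟪g, S - (t : ℝ) • u⟫ + ⟪M (S - (t : ℝ) • z), z - u⟫) ≤
    ‖u - z‖ ^ 2 / 2 - ‖u - w‖ ^ 2 / 2 + t * (η * α / 2) * (‖u - z‖ ^ 2 / 2)
      + η * ⟪N + M (w - z), z - u⟫ + R - η * α / 2 * (‖w - z‖ ^ 2 / 2)

theorem RegretBound.zero {Z : Set E} {M : E →ₗ[ℝ] E} {η α : ℝ} {z g : E} :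
    RegretBound Z M η α z g 0 z 0 0 0 := by
  intro u _
  simp

/-- Two shifts by one step explain the form of `RegretBound`. The sum S contains w₁, …, w_t, whereas
the estimators are queried at w₀, …, w_{t−1}; since w₀ = z, the difference is the boundary term M (w
− z). The gain −(ηα/4)‖w − z‖² enters `R` only when the step from w is made: there it pays for the
variance of the sample drawn at w, and the last one remains available to pay for the boundary term.
-/
theorem RegretBound.step {Z : Set E} {M : E →ₗ[ℝ] E} {η α : ℝ} (hη : 0 ≤ η) (hα : 0 ≤ α)
    {z g w w' S N δ : E} {t : ℕ} {R κ : ℝ} (hκ : κ = 1 / (1 + η * α / 2))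
    (h : ∀ u ∈ Z, ⟪κ • w + ((1 - κ) • z - (η * κ) • g) - (κ * η) • δ - w', u - w'⟫ ≤ 0)
    (hR : RegretBound Z M η α z g t w S N R) :
    RegretBound Z M η α z g (t + 1) w' (S + w') (N + M (w - z) - δ)
      (R + η ^ 2 / 2 * ‖δ‖ ^ 2 - η * ⟪δ, w - z⟫ - η * α / 2 * (‖w - z‖ ^ 2 / 2)) := by
  intro u hu
  have h1 := proximal_step hη hα hκ h hu
  have h2 := hR u hu
  have e1 : S + w' - ((t + 1 : ℕ) : ℝ) • u = (S - (t : ℝ) • u) + (w' - u) := by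
    push_cast
    rw [add_smul, one_smul]
    abel
  have e2 : S + w' - ((t + 1 : ℕ) : ℝ) • z = (S - (t : ℝ) • z) + (w' - z) := by
    push_cast
    rw [add_smul, one_smul]
    abel
  rw [e1, e2, map_add, inner_add_right, inner_add_left]
  simp only [inner_add_left, inner_sub_left _ δ] at h2 ⊢
  push_cast
  linarith

/-- The potential `R + η² ‖N‖² / 2` bounds the regret of the average iterate. -/
theorem RegretBound.final {Z : Set E} {M : E →ₗ[ℝ] E} {η α L : ℝ} (hα : 0 < α)
    (hL : 0 < L) (hη : η = α / (20 * L ^ 2)) (hM : ∀ d, ‖M d‖ ≤ L * ‖d‖)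
    (hskew : ∀ d, ⟪M d, d⟫ = 0) {z g h w S N u : E} {T : ℕ} {R : ℝ} (hT : 6 / (η * α) ≤ T)
    (hR : RegretBound Z M η α z g T w S N R) (hg : g = M z + h) (hu : u ∈ Z) :
    ⟪M ((T : ℝ)⁻¹ • S) + h, (T : ℝ)⁻¹ • S - u⟫ - α * (‖u - z‖ ^ 2 / 2) ≤
      (η * T)⁻¹ * (R + η ^ 2 / 2 * ‖N‖ ^ 2) := by
  have hη0 : 0 < η := by rw [hη]; positivity
  have hT0 : (0 : ℝ) < T := lt_of_lt_of_le (by positivity) hT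
  have hT6 : 6 ≤ η * α * T := by
    rw [div_le_iff₀ (by positivity)] at hT
    linarith
  have h1 := hR u hu
  -- Young's inequality, uniformly in u: this decouples the noise from a comparator chosen after the
  -- samples.
  have h2 : η * ⟪N, z - u⟫ ≤ η ^ 2 / 2 * ‖N‖ ^ 2 + ‖u - z‖ ^ 2 / 2 := by
    have := sq_nonneg ‖η • N - (z - u)‖
    rw [pow_two ‖η • N - (z - u)‖, ← pow_two, norm_sub_sq_real, norm_smul, real_inner_smul_left,
      norm_sub_rev z u, mul_pow, Real.norm_eq_abs, sq_abs] at this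
    nlinarith
  -- The boundary term: its weights are chosen so that the ‖w − z‖² part is exactly the gain left
  -- over in the regret bound, and ηL²/α = 1/20 gives the small coefficient of ‖u − z‖².
  have h3 : η * ⟪M (w - z), z - u⟫ ≤
      η * α / 2 * (‖w - z‖ ^ 2 / 2) + 1 / 10 * (‖u - z‖ ^ 2 / 2) := by
    have h4 : ⟪M (w - z), z - u⟫ ≤ L * ‖w - z‖ * ‖u - z‖ := by
      refine (real_inner_le_norm _ _).trans ?_
      rw [norm_sub_rev z u]
      exact mul_le_mul_of_nonneg_right (hM _) (norm_nonneg _)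
    have h5 : η * L ^ 2 = α / 20 := by rw [hη]; field_simp
    have h6 : η * (L * ‖w - z‖ * ‖u - z‖) ≤
        η * α / 4 * ‖w - z‖ ^ 2 + η * L ^ 2 / α * ‖u - z‖ ^ 2 := by
      have : 0 ≤ η / α * (α / 2 * ‖w - z‖ - L * ‖u - z‖) ^ 2 := by positivity
      have e : η / α * (α / 2 * ‖w - z‖ - L * ‖u - z‖) ^ 2 = η * α / 4 * ‖w - z‖ ^ 2 +
          η * L ^ 2 / α * ‖u - z‖ ^ 2 - η * (L * ‖w - z‖ * ‖u - z‖) := by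
        field_simp
        ring
      linarith
    rw [h5] at h6
    have h7 : α / 20 / α = 1 / 20 := by field_simp
    rw [h7] at h6
    have := mul_le_mul_of_nonneg_left h4 hη0.le
    linarith
  -- With s the average, ⟨g(s), s − u⟩ = ⟨g(z), s − u⟩ + ⟨M(s − z), z − u⟩ + ⟨M(s − z), s − z⟩, and
  -- the last term vanishes by skewness.
  have h4 : ⟪M ((T : ℝ)⁻¹ • S) + h, (T : ℝ)⁻¹ • S - u⟫ =
      (T : ℝ)⁻¹ * (⟪g, S - (T : ℝ) • u⟫ + ⟪M (S - (T : ℝ) • z), z - u⟫) := by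
    set s := (T : ℝ)⁻¹ • S with hs
    have hS : S = (T : ℝ) • s := by rw [hs, smul_inv_smul₀ hT0.ne']
    clear_value s
    rw [hS, hg, ← smul_sub, ← smul_sub, map_smul, real_inner_smul_left, real_inner_smul_right,
      ← mul_add, inv_mul_cancel_left₀ hT0.ne']
    have := hskew (s - z)
    rw [show z - u = (s - u) - (s - z) by abel, inner_sub_right (M (s - z)) (s - u), this, map_sub]
    simp only [inner_add_left, inner_sub_left]
    ring
  rw [h4]
  have h5 : η * (⟪g, S - (T : ℝ) • u⟫ + ⟪M (S - (T : ℝ) • z), z - u⟫) ≤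
      (η * T) * (α * (‖u - z‖ ^ 2 / 2)) + (R + η ^ 2 / 2 * ‖N‖ ^ 2) := by
    -- V_z(u) occurs with total coefficient 1 + 1 + 1/10 + ηαT/2, which is at most ηαT as soon as
    -- ηαT ≥ 4.2.
    have h6 : 0 ≤ (η * α * T - 6) * ‖u - z‖ ^ 2 := mul_nonneg (by linarith) (sq_nonneg _)
    have h7 : 0 ≤ ‖u - z‖ ^ 2 := sq_nonneg _
    have h8 : 0 ≤ ‖u - w‖ ^ 2 := sq_nonneg _
    rw [inner_add_left] at h1
    linarith
  have h6 : 0 < η * T := by positivity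
  calc _ = (η * T)⁻¹ * (η * (⟪g, S - (T : ℝ) • u⟫ + ⟪M (S - (T : ℝ) • z), z - u⟫)) -
        α * (‖u - z‖ ^ 2 / 2) := by field_simp
    _ ≤ (η * T)⁻¹ * ((η * T) * (α * (‖u - z‖ ^ 2 / 2)) + (R + η ^ 2 / 2 * ‖N‖ ^ 2)) -
        α * (‖u - z‖ ^ 2 / 2) := by gcongr
    _ = _ := by field_simp; ring

/-- One extragradient step from `z` to `z'` with gradient `g`. -/
theorem extragradient_step {Z : Set E} {α : ℝ} (hα : 0 < α) {z z' g p : E}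
    (h : ∀ u ∈ Z, ⟪z - α⁻¹ • g - z', u - z'⟫ ≤ 0) {u : E} (hu : u ∈ Z) :
    ⟪g, p - u⟫ ≤ α * (‖u - z‖ ^ 2 / 2 - ‖u - z'‖ ^ 2 / 2) +
      (⟪g, p - z'⟫ - α * (‖z' - z‖ ^ 2 / 2)) := by
  have h1 := mul_nonpos_of_nonneg_of_nonpos hα.le (h u hu)
  rw [← real_inner_smul_left] at h1
  have e : α • (z - α⁻¹ • g - z') = α • z - g - α • z' := by
    rw [smul_sub, smul_sub, smul_inv_smul₀ hα.ne']
  rw [e] at h1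
  simp only [inner_sub_left, inner_sub_right, real_inner_smul_left, norm_sub_sq_real,
    real_inner_self_eq_norm_sq, real_inner_comm z u, real_inner_comm z' u,
    real_inner_comm z z'] at h1 ⊢
  linarith

/-- The variational inequality for the projection onto the unit ball. -/
theorem inner_sub_projBall_nonpos (p u : E) (hu : ‖u‖ ≤ 1) :
    ⟪p - (1 / max ‖p‖ 1) • p, u - (1 / max ‖p‖ 1) • p⟫ ≤ 0 := by
  -- Inside the ball the scaling factor is 1 and the residual is zero. Outside, the residual is a
  -- nonnegative multiple of p, and ⟨p, u⟩ ≤ ‖p‖ = ⟨p, p/‖p‖⟩.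
  rcases le_total ‖p‖ 1 with h | h
  · simp [max_eq_right h]
  · rw [max_eq_left h]
    have hp : 0 < ‖p‖ := by linarith
    have e : p - (1 / ‖p‖) • p = (1 - 1 / ‖p‖) • p := by rw [sub_smul, one_smul]
    rw [e, real_inner_smul_left, inner_sub_right, real_inner_smul_right,
      real_inner_self_eq_norm_sq]
    refine mul_nonpos_of_nonneg_of_nonpos ?_ ?_
    · rw [sub_nonneg, div_le_one hp]
      exact h
    · have h1 : ⟪p, u⟫ ≤ ‖p‖ * ‖u‖ := real_inner_le_norm _ _
      have h2 : 1 / ‖p‖ * ‖p‖ ^ 2 = ‖p‖ := by field_simp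
      nlinarith

theorem norm_projBall_le (p : E) : ‖(1 / max ‖p‖ 1) • p‖ ≤ 1 := by
  have h : 0 < max ‖p‖ 1 := lt_max_of_lt_right one_pos
  rw [norm_smul, Real.norm_eq_abs, abs_of_pos (by positivity), one_div, inv_mul_le_iff₀ h, mul_one]
  exact le_max_left _ _

end regret

/-! ## Evaluation and cost of expressions -/

section eval

variable {m n : ℕ} (G : Game m n) (s : State) (e f : RExp)

@[simp] theorem RExp.eval_add' : (e + f).eval G s = e.eval G s + f.eval G s := rfl
@[simp] theorem RExp.eval_sub' : (e - f).eval G s = e.eval G s - f.eval G s := rfl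
@[simp] theorem RExp.eval_mul' : (e * f).eval G s = e.eval G s * f.eval G s := rfl
@[simp] theorem RExp.eval_div' : (e / f).eval G s = e.eval G s / f.eval G s := rfl
@[simp] theorem RExp.eval_zero : (0 : RExp).eval G s = 0 := Nat.cast_zero
@[simp] theorem RExp.eval_one : (1 : RExp).eval G s = 1 := Nat.cast_one
@[simp] theorem RExp.eval_two : (2 : RExp).eval G s = 2 := Nat.cast_ofNat
@[simp] theorem RExp.eval_six : (6 : RExp).eval G s = 6 := Nat.cast_ofNat
@[simp] theorem RExp.eval_twenty : (20 : RExp).eval G s = 20 := Nat.cast_ofNat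
@[simp] theorem RExp.eval_reg (r : Reg) : (RExp.reg r).eval G s = s.reg r := rfl
@[simp] theorem RExp.eval_max : (RExp.max e f).eval G s =
    Max.max (e.eval G s) (f.eval G s) := rfl
@[simp] theorem RExp.cost_sub' : (e - f).cost = e.cost + f.cost + 1 := rfl
@[simp] theorem RExp.cost_div' : (e / f).cost = e.cost + f.cost + 1 := rfl
@[simp] theorem RExp.cost_zero : (0 : RExp).cost = 1 := rfl

end eval

/-! ## Vectors stored in the memory -/

/-- The dimension of a block. -/
abbrev size (m n : ℕ) : Blk → ℕ
  | .x => n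
  | .y => m

instance : Fintype Blk := ⟨{.x, .y}, by rintro (_ | _) <;> simp⟩

/-- The space of both blocks of variables. -/
abbrev Joint (m n : ℕ) : Type := PiLp 2 fun β : Blk => Vect (size m n β)

/-- The first `d` cells of an array. -/
noncomputable def State.vec (s : State) (a : Arr) (β : Blk) (d : ℕ) : Vect d :=
  WithLp.toLp 2 fun k => s.mem a β k

theorem State.vec_apply (s : State) (a : Arr) (β : Blk) {d : ℕ} (k : Fin d) :
    s.vec a β d k = s.mem a β k := rfl

theorem State.vec_congr {s s' : State} {a : Arr} {β : Blk} (h : s'.mem a β = s.mem a β) (d : ℕ) :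
    s'.vec a β d = s.vec a β d := by
  simp only [State.vec, h]

@[simp] theorem eval_dim {m n : ℕ} (G : Game m n) (s : State) (β : Blk) :
    (dim β).eval G s = size m n β := by
  cases β <;> rfl

@[simp] theorem cost_dim (β : Blk) : (dim β).cost = 1 := by
  cases β <;> rfl

/-! ## The iterate maintainer -/

/-- The maintainer of the block `β` represents the iterate `w` and the sum `S`, with direction `v`. -/
structure Maintains (s : State) (β : Blk) {d : ℕ} (v w S : Vect d) : Prop where
  xiU_pos : 0 < s.reg (.xiU β)
  v_eq : ∀ k : Fin d, s.mem .v β k = v k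
  w_eq : ∀ k : Fin d, s.reg (.xiU β) * s.mem .u β k + s.reg (.xiV β) * s.mem .v β k = w k
  sum_eq : ∀ k : Fin d,
    s.mem .u' β k + s.reg (.sigU β) * s.mem .u β k + s.reg (.sigV β) * s.mem .v β k = S k
  iota_eq : s.reg (.iota β) = ⟪w, v⟫
  nu_eq : s.reg (.nu β) = ‖w‖
  normSqV_eq : s.reg (.normSqV β) = ‖v‖ ^ 2

/-- The registers of the maintainer of the block `β`, and the scratch register. -/
def Reg.maintainer (β : Blk) : Reg → Prop
  | .tmp => True
  | .xiU β' | .xiV β' | .sigU β' | .sigV β' | .iota β' | .nu β' | .normSqV β' => β' = β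
  | _ => False

/-- The arrays of the maintainer of the block `β`. -/
def Arr.maintainer (a : Arr) (β β' : Blk) : Prop := (a = .u ∨ a = .u' ∨ a = .v) ∧ β' = β

/-- `s'` arises from `s` by changes to the maintainer of the block `β` only. -/
structure OnlyMaintainer (β : Blk) (s s' : State) : Prop where
  reg : ∀ r, ¬ r.maintainer β → s'.reg r = s.reg r
  mem : ∀ a β', ¬ a.maintainer β β' → s'.mem a β' = s.mem a β'
  idx : s'.idx = s.idx

theorem OnlyMaintainer.trans {β : Blk} {s s' s'' : State} (h : OnlyMaintainer β s s')
    (h' : OnlyMaintainer β s' s'') : OnlyMaintainer β s s'' :=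
  ⟨fun r hr => (h'.reg r hr).trans (h.reg r hr), fun a β' ha => (h'.mem a β' ha).trans (h.mem a β' ha),
    h'.idx.trans h.idx⟩

theorem OnlyMaintainer.setReg {β : Blk} {s s' : State} {r : Reg} (hr : r.maintainer β) {x : ℝ}
    (h : OnlyMaintainer β s s') : OnlyMaintainer β s (s'.setReg r x) :=
  ⟨fun r' hr' => by
    rw [← h.reg r' hr']
    exact Function.update_of_ne (by rintro rfl; exact hr' hr) _ _, h.mem, h.idx⟩

theorem OnlyMaintainer.setCell {β : Blk} {s s' : State} {a : Arr} (ha : a.maintainer β β) {k : ℕ}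
    {x : ℝ} (h : OnlyMaintainer β s s') : OnlyMaintainer β s (s'.setCell a β k x) :=
  ⟨h.reg, fun a' β' ha' => by
    rw [← h.mem a' β' ha']
    by_cases e : a' = a
    · subst e
      have : β' ≠ β := by rintro rfl; exact ha' ha
      simp [State.setCell, Function.update_of_ne this]
    · simp [State.setCell, Function.update_of_ne e], h.idx⟩

theorem OnlyMaintainer.refl (β : Blk) (s : State) : OnlyMaintainer β s s :=
  ⟨fun _ _ => rfl, fun _ _ _ => rfl, rfl⟩

/-- The maintainers of the two blocks use disjoint registers and arrays, apart from the scratch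
register, which carries no information between operations. -/
theorem Maintains.congr {s s' : State} {β β' : Blk} (hβ : β ≠ β') {d : ℕ} {v w S : Vect d}
    (h : Maintains s β v w S) (hr : ∀ r, ¬ r.maintainer β' → s'.reg r = s.reg r)
    (hmem : ∀ a β, ¬ a.maintainer β' β → s'.mem a β = s.mem a β) : Maintains s' β v w S := by
  obtain ⟨h1, h2, h3, h4, h5, h6, h7⟩ := h
  have hm : ∀ a, s'.mem a β = s.mem a β := fun a => hmem a β fun h => hβ h.2
  constructor <;>
    simpa only [hm, hr (.xiU β) hβ, hr (.xiV β) hβ, hr (.sigU β) hβ, hr (.sigV β) hβ, hr (.iota β) hβ,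
      hr (.nu β) hβ, hr (.normSqV β) hβ]

section maintainer

variable {m n : ℕ} {G : Game m n} {s : State} {β : Blk} {d : ℕ} {v w S : Vect d}

/-- A positive factor keeps ξ_u > 0, on which the division in `imAddSparse` depends, and scales the
stored norm without an absolute value. -/
theorem Maintains.imScale (h : Maintains s β v w S) {e : RExp} (he : 0 < e.eval G s) :
    Spec G (imScale β e) s (e.cost + 17) fun s' =>
      Maintains s' β v (e.eval G s • w) S ∧ OnlyMaintainer β s s' := by
  refine Spec.mono (Spec.seq (Spec.assign (Q := (· = _)) rfl) fun _ h1 =>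
    Spec.seq (Spec.assign (Q := (· = _)) rfl) fun _ h2 =>
    Spec.seq (Spec.assign (Q := (· = _)) rfl) fun _ h3 =>
    Spec.seq (Spec.assign (Q := (· = _)) rfl) fun _ h4 => Spec.assign ?_)
    (by simp [RExp.cost]) fun _ h => h
  subst h4 h3 h2 h1
  refine ⟨?_, (((((OnlyMaintainer.refl β s).setReg (by exact trivial)).setReg (by exact rfl)).setReg (by exact rfl)).setReg (by exact rfl)).setReg (by exact rfl)⟩
  obtain ⟨h1, h2, h3, h4, h5, h6, h7⟩ := h
  constructor
  · simp [State.setReg, RExp.eval]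
    positivity
  · simpa [State.setReg, RExp.eval] using h2
  · intro k
    simp [State.setReg, RExp.eval, ← h3 k]
    ring
  · simpa [State.setReg, RExp.eval] using h4
  · simp [State.setReg, RExp.eval, h5, real_inner_smul_left, mul_comm]
  · simp [State.setReg, RExp.eval, h6, norm_smul, abs_of_pos he, mul_comm]
  · simpa [State.setReg, RExp.eval] using h7

theorem Maintains.imAddDense (h : Maintains s β v w S) :
    Spec G (imAddDense β 1) s 30 fun s' =>
      Maintains s' β v (w + v) S ∧ OnlyMaintainer β s s' := by
  refine Spec.mono (Spec.seq (Spec.assign (Q := (· = _)) rfl) fun _ h1 =>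
    Spec.seq (Spec.assign (Q := (· = _)) rfl) fun _ h2 =>
    Spec.seq (Spec.assign (Q := (· = _)) rfl) fun _ h3 => Spec.assign ?_)
    (by simp [RExp.cost]) fun _ h => h
  subst h3 h2 h1
  refine ⟨?_, ((((OnlyMaintainer.refl β s).setReg (by exact trivial)).setReg (by exact rfl)).setReg (by exact rfl)).setReg (by exact rfl)⟩
  obtain ⟨h1, h2, h3, h4, h5, h6, h7⟩ := h
  constructor
  · simpa [State.setReg, RExp.eval] using h1
  · simpa [State.setReg, RExp.eval] using h2
  · intro k
    simp [State.setReg, RExp.eval, ← h3 k, ← h2 k]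
    ring
  · simpa [State.setReg, RExp.eval] using h4
  · simp [State.setReg, RExp.eval, h5, h7, inner_add_left]
  · simp [State.setReg, RExp.eval, h5, h6, h7]
    rw [← Real.sqrt_sq (norm_nonneg (w + v)), norm_add_sq_real]
    ring_nf
  · simpa [State.setReg, RExp.eval] using h7

/-- Adding c/ξ_u to the cell of u adds c to the iterate, and subtracting cσ_u/ξ_u from the cell of
u' keeps the running sum unchanged. The norm and the inner product are updated by expanding ‖w + c
e_k‖² and ⟨w + c e_k, v⟩, with w_k read before u changes. -/
theorem Maintains.imAddSparse (h : Maintains s β v w S) {e : RExp} {j : Idx} {k : Fin d}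
    (hk : s.idx j = k) : Spec G (imAddSparse β j e) s (e.cost + 60) fun s' =>
      Maintains s' β v (w + EuclideanSpace.single k (e.eval G s)) S ∧ OnlyMaintainer β s s' := by
  refine Spec.mono (Spec.seq (Spec.assign (Q := (· = _)) rfl) fun _ h1 =>
    Spec.seq (Spec.assign (Q := (· = _)) rfl) fun _ h2 =>
    Spec.seq (Spec.assign (Q := (· = _)) rfl) fun _ h3 =>
    Spec.seq (Spec.store (Q := (· = _)) rfl) fun _ h4 => Spec.store ?_)
    (by simp [RExp.cost, imGet]) fun _ h => h
  subst h4 h3 h2 h1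
  refine ⟨?_, (((((OnlyMaintainer.refl β s).setReg (by exact trivial)).setReg (by exact rfl)).setReg (by exact rfl)).setCell
    (by simp [Arr.maintainer])).setCell (by simp [Arr.maintainer])⟩
  obtain ⟨h1, h2, h3, h4, h5, h6, h7⟩ := h
  constructor
  · simpa [State.setReg, State.setCell, RExp.eval] using h1
  · simpa [State.setReg, State.setCell, RExp.eval] using h2
  · intro l
    by_cases hl : l = k
    · subst hl
      simp [State.setReg, State.setCell, RExp.eval, hk, ← h3]
      field_simp
      ring
    · have : (l : ℕ) ≠ k := fun h => hl (Fin.ext h)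
      simp [State.setReg, State.setCell, RExp.eval, hk, ← h3, hl, this]
  · intro l
    by_cases hl : l = k
    · subst hl
      simp [State.setReg, State.setCell, RExp.eval, hk, ← h4]
      field_simp
      ring
    · have : (l : ℕ) ≠ k := fun h => hl (Fin.ext h)
      simp [State.setReg, State.setCell, RExp.eval, hk, ← h4, this]
  · simp [State.setReg, State.setCell, RExp.eval, h5, h2, hk, inner_add_left,
      EuclideanSpace.inner_single_left]
  · simp [State.setReg, State.setCell, RExp.eval, h6, hk, imGet, h3]
    rw [← Real.sqrt_sq (norm_nonneg (w + _)), norm_add_sq_real, EuclideanSpace.inner_single_right,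
      PiLp.norm_single, Real.norm_eq_abs, sq_abs]
    simp only [conj_trivial]
    ring_nf
  · simpa [State.setReg, State.setCell, RExp.eval] using h7

theorem Maintains.imUpdateSum (h : Maintains s β v w S) :
    Spec G (imUpdateSum β) s 8 fun s' =>
      Maintains s' β v w (S + w) ∧ OnlyMaintainer β s s' := by
  refine Spec.mono (Spec.seq (Spec.assign (Q := (· = _)) rfl) fun _ h1 => Spec.assign ?_)
    (by simp [RExp.cost]) fun _ h => h
  subst h1
  refine ⟨?_, ((OnlyMaintainer.refl β s).setReg (by exact rfl)).setReg (by exact rfl)⟩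
  obtain ⟨h1, h2, h3, h4, h5, h6, h7⟩ := h
  constructor
  · simpa [State.setReg, RExp.eval] using h1
  · simpa [State.setReg, RExp.eval] using h2
  · simpa [State.setReg, RExp.eval] using h3
  · intro k
    simp [State.setReg, RExp.eval, ← h3 k, ← h4 k]
    ring
  · simpa [State.setReg, RExp.eval] using h5
  · simpa [State.setReg, RExp.eval] using h6
  · simpa [State.setReg, RExp.eval] using h7

/-- The projection onto the unit ball. -/
noncomputable def projBall (p : Vect d) : Vect d := (1 / max ‖p‖ 1) • p

theorem Maintains.updateBlock (h : Maintains s β v w S) {j : Idx} {k : Fin d}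
    (hk : s.idx j = k) (hκ : 0 < s.reg .kappa) {w' : Vect d}
    (hw : w' = projBall (s.reg .kappa • w + v -
      (s.reg .kappa * s.reg .eta) • EuclideanSpace.single k (s.reg (.coef β)))) :
    Spec G (updateBlock β j) s 150 fun s' =>
      Maintains s' β v w' (S + w') ∧ OnlyMaintainer β s s' := by
  refine Spec.mono (Spec.seq (h.imScale hκ) fun s1 h1 =>
    Spec.seq h1.1.imAddDense fun s2 h2 =>
    Spec.seq (h2.1.imAddSparse (k := k) ?_) fun s3 h3 =>
    Spec.seq (h3.1.imScale ?_) fun s4 h4 => (h4.1.imUpdateSum).mono le_rfl fun s5 h5 => ?_)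
    (by simp [RExp.cost, imGetNorm]) fun _ h => h
  · rw [h2.2.idx, h1.2.idx, hk]
  · simp only [RExp.eval_div', RExp.eval_one, RExp.eval_max]
    positivity
  · refine ⟨?_, h1.2.trans (h2.2.trans (h3.2.trans (h4.2.trans h5.2)))⟩
    -- The coefficient of the sparse update is evaluated only after scaling and dense addition, so
    -- its registers must have survived these.
    have e1 : ∀ r : Reg, ¬ r.maintainer β → s2.reg r = s.reg r := fun r hr => by
      rw [h2.2.reg r hr, h1.2.reg r hr]
    have e2 : (s.reg .kappa • w + v + EuclideanSpace.single k
        ((0 - Reg.kappa * Reg.eta * Reg.coef β : RExp).eval G s2)) =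
        s.reg .kappa • w + v -
      (s.reg .kappa * s.reg .eta) • EuclideanSpace.single k (s.reg (.coef β)) := by
      ext l
      simp [RExp.eval, e1 _ (show ¬ Reg.maintainer β .kappa from id),
        e1 _ (show ¬ Reg.maintainer β .eta from id), e1 _ (show ¬ Reg.maintainer β (.coef β) from id), sub_eq_add_neg]
      split_ifs <;> simp
    have h6 := h5.1
    have h7 := h3.1.nu_eq
    simp only [RExp.eval_div', RExp.eval_one, RExp.eval_max, RExp.eval_reg, imGetNorm, h7] at h6
    rw [e2] at h6
    rw [hw]
    exact h6

end maintainer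

/-! ## The gradient field -/

/-- The linear part `(x, y) ↦ (Aᵀ y, -A x)` of the gradient field. -/
noncomputable def skewMap {m n : ℕ} (A : Matrix (Fin m) (Fin n) ℝ) : Joint m n →ₗ[ℝ] Joint m n where
  toFun z := WithLp.toLp 2 fun β => match β with
    | .x => WithLp.toLp 2 fun j => ∑ i, A i j * z .y i
    | .y => WithLp.toLp 2 fun i => -∑ j, A i j * z .x j
  map_add' z z' := by
    ext (_ | _) k
    · simp [mul_add, Finset.sum_add_distrib]
    · simp [mul_add, Finset.sum_add_distrib, add_comm]
  map_smul' t z := by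
    ext (_ | _) k <;> simp [Finset.mul_sum, mul_left_comm]

/-- The constant part `(b, c)` of the gradient field. -/
noncomputable def linTerm {m n : ℕ} (b : Fin n → ℝ) (c : Fin m → ℝ) : Joint m n :=
  WithLp.toLp 2 fun β => match β with
    | .x => WithLp.toLp 2 b
    | .y => WithLp.toLp 2 c

/-- The point stored in an array. -/
noncomputable def State.point (s : State) (m n : ℕ) (a : Arr) : Joint m n :=
  WithLp.toLp 2 fun β => s.vec a β (size m n β)

@[simp] theorem coord_val {d : ℕ} (v : Fin d → ℝ) (k : Fin d) : coord v k = v k := by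
  simp [coord]

section specs

variable {m n : ℕ} {G : Game m n} {s : State}

/-- A loop that writes the vector `f` to the array `a`. -/
theorem Spec.fill {d : ℕ} {a : Arr} {β : Blk} {e ex : RExp} (f : Fin d → ℝ)
    (hd : e.eval G s = d)
    (hf : ∀ (k : Fin d) (s' : State), s'.reg = s.reg →
      (∀ a' β', (a' = a → β' ≠ β) → s'.mem a' β' = s.mem a' β') →
      s'.idx .l = k → ex.eval G s' = f k) :
    Spec G (.loop .l e (.store a β .l ex)) s (d * (ex.cost + 2) + e.cost + 1) fun s' =>
      s'.reg = s.reg ∧ (∀ a' β', (a' = a → β' ≠ β) → s'.mem a' β' = s.mem a' β') ∧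
      ∀ k : Fin d, s'.mem a β k = f k := by
  refine (Spec.loop (fun k s' => s'.reg = s.reg ∧
    (∀ a' β', (a' = a → β' ≠ β) → s'.mem a' β' = s.mem a' β') ∧
      ∀ j : Fin d, (j : ℕ) < k → s'.mem a β j = f j) (N := d) (by rw [hd, Nat.ceil_natCast])
      ⟨rfl, fun _ _ _ => rfl, fun j hj => absurd hj (Nat.not_lt_zero _)⟩
      fun k hk s' hs' => Spec.store ?_).mono le_rfl fun s' h =>
      ⟨h.1, h.2.1, fun k => h.2.2 k k.2⟩
  obtain ⟨h1, h2, h3⟩ := hs'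
  have hv : ex.eval G (s'.setIdx .l k) = f ⟨k, hk⟩ := hf ⟨k, hk⟩ _ h1 h2 (by simp [State.setIdx])
  refine ⟨h1, fun a' β' h => ?_, fun j hj => ?_⟩
  · rw [← h2 a' β' h]
    by_cases e : a' = a
    · subst e
      simp [State.setCell, Function.update_of_ne (h rfl), State.setIdx]
    · simp [State.setCell, Function.update_of_ne e, State.setIdx]
  · rw [hv]
    rcases Nat.lt_succ_iff_lt_or_eq.1 hj with hj | hj
    · simp [State.setCell, State.setIdx, hj.ne, h3 j hj]
    · simp [State.setCell, State.setIdx, ← hj]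

/-- This makes a pass over the nonzero entries, in whatever order, equivalent to a product with the
full matrix. -/
theorem sum_nz (G : Game m n) (φ : Fin m → Fin n → ℝ) (hφ : ∀ i j, G.A i j = 0 → φ i j = 0) :
    ∑ k, φ (G.nz k).1.1 (G.nz k).1.2 = ∑ i, ∑ j, φ i j := by
  classical
  rw [G.nz.sum_comp fun p => φ p.1.1 p.1.2, ← Fintype.sum_prod_type']
  refine (Finset.sum_subtype (Finset.univ.filter fun p : Fin m × Fin n => G.A p.1 p.2 ≠ 0)
    (by simp) fun p => φ p.1 p.2).symm.trans ?_
  rw [Finset.sum_filter]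
  refine Finset.sum_congr rfl fun p _ => ?_
  split_ifs with h
  · rfl
  · exact (hφ _ _ (not_not.1 h)).symm

theorem sum_ite_lt_succ {d k : ℕ} (hk : k < d) (φ : Fin d → ℝ) :
    (∑ j : Fin d, if (j : ℕ) < k + 1 then φ j else 0) =
      (∑ j : Fin d, if (j : ℕ) < k then φ j else 0) + φ ⟨k, hk⟩ := by
  rw [← Fintype.sum_ite_eq (⟨k, hk⟩ : Fin d) φ, ← Finset.sum_add_distrib]
  refine Finset.sum_congr rfl fun j _ => ?_
  have : (⟨k, hk⟩ : Fin d) = j ↔ (j : ℕ) = k := by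
    rw [Fin.ext_iff]
    exact eq_comm
  simp only [this]
  split_ifs <;> first | omega | simp

/-- One pass over the nonzero entries updates both blocks; the invariant holds the partial sums over
the entries visited so far. The condition on `a` ensures that the point read is not overwritten. -/
theorem Spec.gradientOf {a : Arr} (ha : a ≠ .grad) :
    Spec G (gradientOf a) s (4 * n + 4 * m + 20 * nnz G.A + 20) fun s' =>
      s'.reg = s.reg ∧ (∀ a', a' ≠ .grad → s'.mem a' = s.mem a') ∧
      s'.point m n .grad = skewMap G.A (s.point m n a) + linTerm G.b G.c := by
  classical
  set φx : Fin m → Fin n → Fin n → ℝ := fun i j' j =>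
    if j' = j then G.A i j' * s.mem a .y i else 0 with hφx
  set φy : Fin m → Fin n → Fin m → ℝ := fun i' j i =>
    if i' = i then G.A i' j * s.mem a .x j else 0 with hφy
  refine Spec.mono (Spec.seq (Spec.fill (d := n) G.b rfl fun k s' _ _ hk => ?_) fun s1 h1 =>
    Spec.seq (Spec.fill (d := m) G.c rfl fun k s' _ _ hk => ?_) fun s2 h2 =>
    (Spec.loop (N := nnz G.A) (c := 17) (fun k s' => s'.reg = s.reg ∧
      (∀ a', a' ≠ .grad → s'.mem a' = s.mem a') ∧
      (∀ j : Fin n, s'.mem .grad .x j = G.b j +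
        ∑ k' : Fin (nnz G.A), if k' < k then φx (G.nz k').1.1 (G.nz k').1.2 j else 0) ∧
      ∀ i : Fin m, s'.mem .grad .y i = G.c i -
        ∑ k' : Fin (nnz G.A), if k' < k then φy (G.nz k').1.1 (G.nz k').1.2 i else 0)
      (Nat.ceil_natCast _) ?_ fun k hk s' hs' => ?_).mono le_rfl fun s3 h3 => ?_)
    (by simp [RExp.cost]; omega) fun _ h => h
  · simp [RExp.eval, hk]
  · simp [RExp.eval, hk]
  · obtain ⟨h11, h12, h13⟩ := h1
    obtain ⟨h21, h22, h23⟩ := h2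
    refine ⟨h21.trans h11, fun a' ha' => funext fun β => ?_, fun j => ?_, fun i => ?_⟩
    · rw [h22 _ _ fun h => absurd h ha', h12 _ _ fun h => absurd h ha']
    · rw [h22 _ _ (by simp), h13]
      simp
    · rw [h23]
      simp
  · obtain ⟨h1, h2, h3, h4⟩ := hs'
    have hl : (s'.setIdx .l k).idx .l = k := by simp [State.setIdx]
    refine Spec.mono (Spec.seq (Spec.nzPos (Q := (· = _)) (by rwa [hl]) rfl) fun s1 e1 =>
      Spec.seq (Spec.store (Q := (· = _)) rfl) fun s2 e2 => Spec.store ?_)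
      (by simp [RExp.cost]) fun _ h => h
    simp only [hl] at e1
    set i₀ := (G.nz ⟨k, hk⟩).1.1
    set j₀ := (G.nz ⟨k, hk⟩).1.2
    have hm : ∀ (β : Blk), s'.mem a β = s.mem a β := fun β => by rw [h2 a ha]
    subst e2 e1
    refine ⟨h1, fun a' ha' => ?_, fun j => ?_, fun i => ?_⟩
    · rw [← h2 a' ha']
      simp [State.setCell, State.setIdx, Function.update_of_ne ha']
    · rw [sum_ite_lt_succ hk fun k' => φx (G.nz k').1.1 (G.nz k').1.2 j, ← add_assoc, ← h3 j]
      by_cases hj : j = j₀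
      · simp [State.setCell, State.setIdx, RExp.eval, hj, hφx, hm, Function.update_of_ne ha]
        exact (if_pos rfl).symm
      · have hj' : (j : ℕ) ≠ j₀ := fun h => hj (Fin.ext h)
        have hj'' : (G.nz ⟨k, hk⟩).1.2 ≠ j := fun h => hj h.symm
        simp [State.setCell, State.setIdx, RExp.eval, hj', hφx, hj'']
    · rw [sum_ite_lt_succ hk fun k' => φy (G.nz k').1.1 (G.nz k').1.2 i, ← sub_sub, ← h4 i]
      by_cases hi : i = i₀
      · simp [State.setCell, State.setIdx, RExp.eval, hi, hφy, hm, Function.update_of_ne ha]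
        exact (if_pos rfl).symm
      · have hi' : (i : ℕ) ≠ i₀ := fun h => hi (Fin.ext h)
        have hi'' : (G.nz ⟨k, hk⟩).1.1 ≠ i := fun h => hi h.symm
        simp [State.setCell, State.setIdx, RExp.eval, hi', hφy, hi'']
  · obtain ⟨h31, h32, h33, h34⟩ := h3
    refine ⟨h31, h32, ?_⟩
    ext (_ | _) k
    · change s3.mem .grad .x k = (∑ i, G.A i k * s.mem a .y i) + G.b k
      rw [h33, add_comm]
      simp only [Fin.is_lt, if_true]
      rw [sum_nz G (fun i j => φx i j k) fun i j h => by simp [hφx, h]]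
      simp [hφx]
    · change s3.mem .grad .y k = -(∑ j, G.A k j * s.mem a .x j) + G.c k
      rw [h34, sub_eq_neg_add]
      simp only [Fin.is_lt, if_true]
      rw [sum_nz G (fun i j => φy i j k) fun i j h => by simp [hφy, h], Finset.sum_comm]
      simp [hφy]

/-- The expression `e` is evaluated while the maintainer is half written, so its value is required
in every state that agrees with `s` off the maintainer. The register ν accumulates the squared norm
and receives its square root after the loop. -/
theorem Spec.imInit {β : Blk} {e : RExp} {x₀ : Arr} (hx₀ : ∀ β', ¬ x₀.maintainer β β')
    {x v : Vect (size m n β)} (hx : ∀ k : Fin (size m n β), s.mem x₀ β k = x k)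
    (hv : ∀ (k : Fin (size m n β)) (s' : State), (∀ r, ¬ r.maintainer β → s'.reg r = s.reg r) →
      (∀ a' β', ¬ a'.maintainer β β' → s'.mem a' β' = s.mem a' β') → s'.idx .l = k →
      e.eval G s' = v k) :
    Spec G (imInit β x₀ e) s (size m n β * (e.cost + 30) + 30) fun s' =>
      (∀ r, ¬ r.maintainer β → s'.reg r = s.reg r) ∧
      (∀ a' β', ¬ a'.maintainer β β' → s'.mem a' β' = s.mem a' β') ∧
      Maintains s' β v x 0 := by
  have hu : Arr.maintainer .u β β := by simp [Arr.maintainer]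
  have hu' : Arr.maintainer .u' β β := by simp [Arr.maintainer]
  have hv' : Arr.maintainer .v β β := by simp [Arr.maintainer]
  refine Spec.mono (Spec.seq (Spec.assign (Q := (· = _)) rfl) fun s1 h1 =>
    Spec.seq (Spec.assign (Q := (· = _)) rfl) fun s2 h2 =>
    Spec.seq (Spec.assign (Q := (· = _)) rfl) fun s3 h3 =>
    Spec.seq (Spec.loop (N := size m n β) (c := e.cost + 28) (fun k s' =>
      (∀ r, ¬ r.maintainer β → s'.reg r = s.reg r) ∧
      (∀ a' β', ¬ a'.maintainer β β' → s'.mem a' β' = s.mem a' β') ∧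
      (∀ j : Fin (size m n β), (j : ℕ) < k →
        s'.mem .u β j = x j ∧ s'.mem .u' β j = 0 ∧ s'.mem .v β j = v j) ∧
      s'.reg (.normSqV β) = (∑ j : Fin (size m n β), if (j : ℕ) < k then v j * v j else 0) ∧
      s'.reg (.iota β) = (∑ j : Fin (size m n β), if (j : ℕ) < k then x j * v j else 0) ∧
      s'.reg (.nu β) = (∑ j : Fin (size m n β), if (j : ℕ) < k then x j * x j else 0))
      (by rw [eval_dim, Nat.ceil_natCast]) ?_ fun k hk s' hs' => ?_) fun s4 h4 =>
    Spec.seq (Spec.assign (Q := (· = _)) rfl) fun s5 h5 =>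
    Spec.seq (Spec.assign (Q := (· = _)) rfl) fun s6 h6 =>
    Spec.seq (Spec.assign (Q := (· = _)) rfl) fun s7 h7 =>
    Spec.seq (Spec.assign (Q := (· = _)) rfl) fun s8 h8 => Spec.assign ?_)
    (by simp [RExp.cost]; ring_nf; omega) fun _ h => h
  · subst h3 h2 h1
    refine ⟨?_, fun _ _ _ => rfl, fun j hj => absurd hj (Nat.not_lt_zero _), ?_, ?_, ?_⟩
    · exact ((((OnlyMaintainer.refl β s).setReg (by exact rfl)).setReg (by exact rfl)).setReg
        (by exact rfl)).reg
    all_goals simp [State.setReg]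
  · obtain ⟨h1, h2, h3, h4, h5, h6⟩ := hs'
    have hl : (s'.setIdx .l k).idx .l = k := by simp [State.setIdx]
    have hx' : (s'.setIdx .l k).mem x₀ β k = x ⟨k, hk⟩ := by
      rw [← hx]
      exact congrFun (h2 _ _ (hx₀ β)) k
    refine Spec.mono (Spec.seq (Spec.store (Q := (· = _)) rfl) fun s1 e1 =>
      Spec.seq (Spec.store (Q := (· = _)) rfl) fun s2 e2 =>
      Spec.seq (Spec.store (Q := (· = _)) rfl) fun s3 e3 =>
      Spec.seq (Spec.assign (Q := (· = _)) rfl) fun s4 e4 =>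
      Spec.seq (Spec.assign (Q := (· = _)) rfl) fun s5 e5 => Spec.assign ?_)
      (by simp [RExp.cost]; omega) fun _ h => h
    have o0 : OnlyMaintainer β (s'.setIdx .l k) s2 := by
      subst e2 e1
      exact ((OnlyMaintainer.refl β _).setCell hu).setCell hu'
    have hvk : e.eval G s2 = v ⟨k, hk⟩ := by
      refine hv ⟨k, hk⟩ s2 (fun r hr => ?_) (fun a' β' ha' => ?_) (by rw [o0.idx, hl])
      · rw [o0.reg r hr, ← h1 r hr]
        rfl
      · rw [o0.mem a' β' ha', ← h2 a' β' ha']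
        rfl
    rw [hvk] at e3
    have o1 : OnlyMaintainer β (s'.setIdx .l k) (s5.setReg (.nu β)
        ((Reg.nu β + RExp.cell .u β .l * RExp.cell .u β .l : RExp).eval G s5)) := by
      subst e5 e4 e3
      exact (((o0.setCell hv').setReg (by exact rfl)).setReg (by exact rfl)).setReg (by exact rfl)
    refine ⟨fun r hr => (o1.reg r hr).trans (h1 r hr),
      fun a' β' ha' => (o1.mem a' β' ha').trans (h2 a' β' ha'), ?_⟩
    have hidx : ∀ s' : State, ∀ a β k x, (s'.setCell a β k x).idx = s'.idx := fun _ _ _ _ _ => rfl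
    simp only [RExp.eval, hl, hx'] at e1
    subst e1
    simp only [RExp.eval_zero, hidx, hl] at e2
    subst e2
    simp only [hidx, hl] at e3
    subst e5 e4 e3
    rw [sum_ite_lt_succ hk, sum_ite_lt_succ hk, sum_ite_lt_succ hk]
    refine ⟨fun j hj => ?_, ?_, ?_, ?_⟩
    · rcases Nat.lt_succ_iff_lt_or_eq.1 hj with hj' | hj'
      · obtain ⟨h31, h32, h33⟩ := h3 j hj'
        simp [State.setReg, State.setCell, State.setIdx, hj'.ne, h31, h32, h33]
      · subst hj'
        simp [State.setReg, State.setCell, State.setIdx]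
    · simp [State.setReg, State.setCell, State.setIdx, RExp.eval, h4]
    · simp [State.setReg, State.setCell, State.setIdx, RExp.eval, h5]
    · simp [State.setReg, State.setCell, State.setIdx, RExp.eval, h6]
  · obtain ⟨h41, h42, h43, h44, h45, h46⟩ := h4
    have o : OnlyMaintainer β s4 (s8.setReg (.sigV β) ((0 : RExp).eval G s8)) := by
      subst h8 h7 h6 h5
      exact (((((OnlyMaintainer.refl β s4).setReg (by exact rfl)).setReg (by exact rfl)).setReg
        (by exact rfl)).setReg (by exact rfl)).setReg (by exact rfl)
    refine ⟨fun r hr => (o.reg r hr).trans (h41 r hr),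
      fun a' β' ha' => (o.mem a' β' ha').trans (h42 a' β' ha'), ?_⟩
    simp only [Fin.is_lt, if_true] at h44 h45 h46
    subst h8 h7 h6 h5
    constructor
    · simp [State.setReg]
    · simpa [State.setReg] using fun k => (h43 k k.2).2.2
    · simpa [State.setReg] using fun k => (h43 k k.2).1
    · simpa [State.setReg] using fun k => (h43 k k.2).2.1
    · simp [State.setReg, h45, PiLp.inner_apply, mul_comm]
    · simp [State.setReg, h46, RExp.eval, EuclideanSpace.norm_eq, pow_two]
    · simp [State.setReg, h44, RExp.eval, EuclideanSpace.norm_sq_eq]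
      simp [pow_two]

end specs

theorem sum_blk {M : Type*} [AddCommMonoid M] (f : Blk → M) : ∑ β, f β = f .x + f .y :=
  Finset.sum_pair (by simp)

/-! ## The parameters -/

section parameters

variable {m n : ℕ}

/-- The inner step size `η = α / (20 L_co²)`. -/
noncomputable def etaOpt (A : Matrix (Fin m) (Fin n) ℝ) (ε : ℝ) : ℝ :=
  alphaOpt A ε / (20 * Lco A ^ 2)

/-- The shrinkage factor `κ = 1 / (1 + η α / 2)`. -/
noncomputable def kappaOpt (A : Matrix (Fin m) (Fin n) ℝ) (ε : ℝ) : ℝ :=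
  1 / (1 + etaOpt A ε * alphaOpt A ε / 2)

/-- The number of inner steps. -/
noncomputable def numInner (A : Matrix (Fin m) (Fin n) ℝ) (ε : ℝ) : ℕ :=
  ⌈6 / (etaOpt A ε * alphaOpt A ε)⌉₊

/-- The number of outer steps. -/
noncomputable def numOuter (A : Matrix (Fin m) (Fin n) ℝ) (ε : ℝ) : ℕ := ⌈alphaOpt A ε / ε⌉₊

/-- The registers hold the parameters of the method. -/
structure Params (G : Game m n) (s : State) : Prop where
  sumRow : s.reg .sumRow = ∑ i, rowNorm G.A i ^ 2
  sumCol : s.reg .sumCol = ∑ j, colNorm G.A j ^ 2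
  alpha : s.reg .alpha = alphaOpt G.A G.eps
  eta : s.reg .eta = etaOpt G.A G.eps
  kappa : s.reg .kappa = kappaOpt G.A G.eps
  numT : s.reg .numT = numInner G.A G.eps
  numK : s.reg .numK = numOuter G.A G.eps

/-- The registers that hold the parameters. -/
def Reg.param : Reg → Prop
  | .sumRow | .sumCol | .alpha | .eta | .kappa | .numT | .numK => True
  | _ => False

theorem Params.congr {G : Game m n} {s s' : State} (h : Params G s)
    (hs : ∀ r : Reg, r.param → s'.reg r = s.reg r) : Params G s' := by
  obtain ⟨h1, h2, h3, h4, h5, h6, h7⟩ := h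
  constructor
  · rw [hs _ (by exact trivial), h1]
  · rw [hs _ (by exact trivial), h2]
  · rw [hs _ (by exact trivial), h3]
  · rw [hs _ (by exact trivial), h4]
  · rw [hs _ (by exact trivial), h5]
  · rw [hs _ (by exact trivial), h6]
  · rw [hs _ (by exact trivial), h7]

theorem Lco_sq (A : Matrix (Fin m) (Fin n) ℝ) :
    Lco A ^ 2 = (∑ i, rowNorm A i ^ 2) + ∑ j, colNorm A j ^ 2 :=
  Real.sq_sqrt (by positivity)

/-- A loop that accumulates a sum in a register. -/
theorem Spec.accumulate {G : Game m n} {s : State} {N : ℕ} {r : Reg} {e ex : RExp}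
    (f : ℕ → ℝ) (hN : ⌈e.eval G s⌉₊ = N) (hr : s.reg r = 0)
    (hf : ∀ k < N, ∀ s', s'.idx .l = k → ex.eval G s' = s'.reg r + f k) :
    Spec G (.loop .l e (.assign r ex)) s (N * (ex.cost + 2) + e.cost + 1) fun s' =>
      s'.mem = s.mem ∧ (∀ r', r' ≠ r → s'.reg r' = s.reg r') ∧
      s'.reg r = ∑ k ∈ Finset.range N, f k := by
  refine Spec.loop (fun k s' => s'.mem = s.mem ∧ (∀ r', r' ≠ r → s'.reg r' = s.reg r') ∧
      s'.reg r = ∑ k ∈ Finset.range k, f k) hN ⟨rfl, fun _ _ => rfl, by simpa⟩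
      fun k hk s' hs' => Spec.assign ?_
  obtain ⟨h1, h2, h3⟩ := hs'
  rw [hf k hk _ (by simp [State.setIdx]), Finset.sum_range_succ, ← h3]
  exact ⟨h1, fun r' hr' => by rw [← h2 r' hr']; simp [State.setReg, State.setIdx, hr'],
    by simp [State.setReg, State.setIdx]⟩

/-- The machine has no ceiling operation: T and K arise by counting the rounds of a loop with a real
bound, which contributes T and K to the cost. -/
theorem Spec.parameters {G : Game m n} {s : State} :
    Spec G parameters s (10 * (m + n + numInner G.A G.eps + numOuter G.A G.eps) + 100)
      fun s' => Params G s' ∧ s'.mem = s.mem := by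
  refine Spec.mono (Spec.seq (Spec.assign (Q := (· = _)) rfl) fun s1 h1 =>
    Spec.seq (Spec.assign (Q := (· = _)) rfl) fun s2 h2 =>
    Spec.seq (Spec.accumulate (N := m) (coord fun i => rowNorm G.A i ^ 2) ?_ ?_ ?_) fun s3 h3 =>
    Spec.seq (Spec.accumulate (N := n) (coord fun j => colNorm G.A j ^ 2) ?_ ?_ ?_) fun s4 h4 =>
    Spec.seq (Spec.assign (Q := (· = _)) rfl) fun s5 h5 =>
    Spec.seq (Spec.assign (Q := (· = _)) rfl) fun s6 h6 =>
    Spec.seq (Spec.assign (Q := (· = _)) rfl) fun s7 h7 =>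
    Spec.seq (Spec.assign (Q := (· = _)) rfl) fun s8 h8 =>
    Spec.seq (Spec.accumulate (N := numInner G.A G.eps) (fun _ => 1) ?_ ?_ ?_) fun s9 h9 =>
    Spec.seq (Spec.assign (Q := (· = _)) rfl) fun s10 h10 =>
    (Spec.accumulate (N := numOuter G.A G.eps) (fun _ => 1) ?_ ?_ ?_).mono le_rfl fun s11 h11 => ?_)
    (by simp [RExp.cost]; omega) fun _ h => h
  · exact Nat.ceil_natCast m
  · subst h2 h1
    simp [State.setReg]
  · intro k hk s' hl
    simp [RExp.eval, hl, coord, hk, pow_two]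
  · exact Nat.ceil_natCast n
  · rw [h3.2.1 _ (by simp)]
    subst h2 h1
    simp [State.setReg]
  · intro k hk s' hl
    simp [RExp.eval, hl, coord, hk, pow_two]
  all_goals
    have hrow : s4.reg .sumRow = ∑ i, rowNorm G.A i ^ 2 := by
      rw [h4.2.1 _ (by simp), h3.2.2, Finset.sum_range]
      simp
    have hcol : s4.reg .sumCol = ∑ j, colNorm G.A j ^ 2 := by
      rw [h4.2.2, Finset.sum_range]
      simp
    have hα : s5.reg .alpha = alphaOpt G.A G.eps := by
      subst h5
      simp [State.setReg, RExp.eval, hrow, hcol, alphaOpt, Lco]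
    have hη : s6.reg .eta = etaOpt G.A G.eps := by
      subst h6
      simp [State.setReg, hα, etaOpt, Lco_sq, ← hrow, ← hcol]
      simp [h5, State.setReg]
    have hκ : s7.reg .kappa = kappaOpt G.A G.eps := by
      subst h7
      simp [State.setReg, kappaOpt, ← hη, ← hα]
      simp [h6, State.setReg]
  · subst h8 h7
    simp only [State.setReg, RExp.eval_div', RExp.eval_six, RExp.eval_mul', RExp.eval_reg]
    simp [hη, numInner, ← hα]
    simp [h6, State.setReg]
  · subst h8
    simp [State.setReg]
  · intro k hk s' hl
    simp
  all_goals
    have h8r : ∀ r, r ≠ .numT → s9.reg r = s7.reg r := fun r hr => by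
      rw [h9.2.1 r hr]
      subst h8
      simp [State.setReg, hr]
    have hα' : s9.reg .alpha = alphaOpt G.A G.eps := by
      rw [h8r _ (by simp), ← hα]
      subst h7 h6
      simp [State.setReg]
  · subst h10
    simp only [State.setReg, RExp.eval_div', RExp.eval]
    simp [hα', numOuter]
  · subst h10
    simp [State.setReg]
  · intro k hk s' hl
    simp
  · have h9r : ∀ r, r ≠ .numT → r ≠ .numK → s11.reg r = s7.reg r := fun r hr hr' => by
      rw [h11.2.1 r hr', ← h8r r hr]
      subst h10
      simp [State.setReg, hr']
    refine ⟨⟨?_, ?_, ?_, ?_, ?_, ?_, ?_⟩, ?_⟩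
    · rw [h9r _ (by simp) (by simp), ← hrow]
      subst h7 h6 h5
      simp [State.setReg]
    · rw [h9r _ (by simp) (by simp), ← hcol]
      subst h7 h6 h5
      simp [State.setReg]
    · rw [h9r _ (by simp) (by simp), ← hα]
      subst h7 h6
      simp [State.setReg]
    · rw [h9r _ (by simp) (by simp), ← hη]
      subst h7
      simp [State.setReg]
    · rw [h9r _ (by simp) (by simp), ← hκ]
    · rw [h11.2.1 _ (by simp)]
      subst h10
      simp [State.setReg, h9.2.2]
    · rw [h11.2.2]
      simp
    · rw [h11.1, h10]
      change s9.mem = _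
      rw [h9.1, h8, h7, h6, h5]
      change s4.mem = _
      rw [h4.1, h3.1, h2, h1]
      rfl

end parameters

/-! ## The extragradient step -/

section extragradient

variable {m n : ℕ} {G : Game m n} {s : State}

/-- The projection factor needs the norm of the whole block, hence two passes, each overwriting
`center` in place. The invariants describe separately the cells already visited and those still
untouched. -/
theorem Spec.extragradient {β : Blk} {d : ℕ} (hd : d = size m n β) {z g h H : Vect d}
    (hz : s.vec .center β d = z) (hg : s.vec .grad β d = g)
    (hh : s.vec .half β d = h) (hH : s.vec .total β d = H) :
    Spec G (extragradient β) s (d * 40 + 40) fun s' =>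
      (∀ r, r ≠ .acc → s'.reg r = s.reg r) ∧
      (∀ a β', (a ≠ .total ∧ a ≠ .center ∨ β' ≠ β) → s'.mem a β' = s.mem a β') ∧
      s'.vec .center β d = projBall (z - (s.reg .alpha)⁻¹ • g) ∧
      s'.vec .total β d = H + h := by
  set p : Vect d := z - (s.reg .alpha)⁻¹ • g with hp
  have hpj : ∀ j : Fin d, s.mem .center β j - s.mem .grad β j / s.reg .alpha = p j := by
    intro j
    rw [hp, ← hz, ← hg]
    simp [State.vec_apply, div_eq_inv_mul]
  refine Spec.mono (Spec.seq (Spec.assign (Q := (· = _)) rfl) fun s1 h1 =>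
    Spec.seq (Spec.loop (N := d) (c := 20) (fun k s' =>
      (∀ r, r ≠ .acc → s'.reg r = s.reg r) ∧
      (∀ a β', (a ≠ .total ∧ a ≠ .center ∨ β' ≠ β) → s'.mem a β' = s.mem a β') ∧
      (∀ j : Fin d, (j : ℕ) < k → s'.mem .center β j = p j ∧ s'.mem .total β j = H j + h j) ∧
      (∀ j : Fin d, k ≤ j → s'.mem .center β j = s.mem .center β j ∧
        s'.mem .total β j = s.mem .total β j) ∧
      s'.reg .acc = (∑ j : Fin d, if (j : ℕ) < k then p j * p j else 0))
      (by rw [eval_dim, ← hd, Nat.ceil_natCast]) ?_ fun k hk s' hs' => ?_) fun s2 h2 =>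
    Spec.seq (Spec.assign (Q := (· = _)) rfl) fun s3 h3 =>
    (Spec.loop (N := d) (c := 4) (fun k s' =>
      (∀ r, s'.reg r = s3.reg r) ∧
      (∀ a β', (a ≠ .center ∨ β' ≠ β) → s'.mem a β' = s3.mem a β') ∧
      (∀ j : Fin d, (j : ℕ) < k → s'.mem .center β j = p j / s3.reg .acc) ∧
      (∀ j : Fin d, k ≤ j → s'.mem .center β j = p j))
      (by rw [eval_dim, ← hd, Nat.ceil_natCast]) ?_ fun k hk s' hs' => ?_).mono le_rfl fun s4 h4 => ?_)
    (by simp [RExp.cost]; omega) fun _ h => h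
  · subst h1
    refine ⟨fun r hr => by simp [State.setReg, hr], fun _ _ _ => rfl,
      fun j hj => absurd hj (Nat.not_lt_zero _), fun _ _ => ⟨rfl, rfl⟩, by simp [State.setReg]⟩
  · obtain ⟨h1, h2, h3, h4, h5⟩ := hs'
    refine Spec.mono (Spec.seq (Spec.store (Q := (· = _)) rfl) fun s1 e1 =>
      Spec.seq (Spec.store (Q := (· = _)) rfl) fun s2 e2 => Spec.assign ?_)
      (by simp [RExp.cost]) fun _ h => h
    have hα := h1 .alpha (by simp)
    have hgr : s'.mem .grad β = s.mem .grad β := h2 _ _ (by simp)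
    have hha : s'.mem .half β = s.mem .half β := h2 _ _ (by simp)
    have hidx : (s'.setIdx .l k).idx .l = k := by simp [State.setIdx]
    obtain ⟨h41, h42⟩ := h4 ⟨k, hk⟩ le_rfl
    have hpk := hpj ⟨k, hk⟩
    have hHk : s.mem .total β k = H ⟨k, hk⟩ := by rw [← hH]; rfl
    have hhk : s.mem .half β k = h ⟨k, hk⟩ := by rw [← hh]; rfl
    simp only at h41 h42 hpk
    subst e2 e1
    rw [sum_ite_lt_succ hk]
    refine ⟨fun r hr => ?_, fun a β' ha => ?_, fun j hj => ?_, fun j hj => ?_, ?_⟩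
    · rw [← h1 r hr]
      simp [State.setReg, State.setCell, State.setIdx, hr]
    · rw [← h2 a β' ha]
      rcases ha with ⟨ha, ha'⟩ | ha
      · simp [State.setReg, State.setCell, State.setIdx, Function.update_of_ne ha,
          Function.update_of_ne ha']
      · simp only [State.setReg, State.setCell, State.setIdx, Function.update_apply]
        split_ifs <;> simp_all
    · rcases Nat.lt_succ_iff_lt_or_eq.1 hj with hj' | hj'
      · simp [State.setReg, State.setCell, State.setIdx, hj'.ne, h3 j hj']
      · subst hj'
        simp [State.setReg, State.setCell, State.setIdx, RExp.eval, hgr, hha, h41, h42, hα, hpk,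
          hHk, hhk]
    · have hj' : (j : ℕ) ≠ k := by omega
      simp [State.setReg, State.setCell, State.setIdx, hj', h4 j (by omega)]
    · simp [State.setReg, State.setCell, State.setIdx, RExp.eval, hgr, h41, hα, hpk, h5]
  · subst h3
    exact ⟨fun _ => rfl, fun _ _ _ => rfl, fun j hj => absurd hj (Nat.not_lt_zero _),
      fun j _ => (h2.2.2.1 j j.2).1⟩
  · obtain ⟨h1, h2, h3, h4⟩ := hs'
    refine (Spec.store (Q := fun s' => _) ?_).mono (by simp [RExp.cost]) fun _ h => h
    have h4k := h4 ⟨k, hk⟩ le_rfl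
    simp only at h4k
    refine ⟨fun r => h1 r, fun a β' ha => ?_, fun j hj => ?_, fun j hj => ?_⟩
    · rw [← h2 a β' ha]
      rcases ha with ha | ha
      · simp [State.setCell, State.setIdx, Function.update_of_ne ha]
      · simp only [State.setCell, State.setIdx, Function.update_apply]
        split_ifs <;> simp_all
    · rcases Nat.lt_succ_iff_lt_or_eq.1 hj with hj' | hj'
      · simp [State.setCell, State.setIdx, hj'.ne, h3 j hj']
      · subst hj'
        simp [State.setCell, State.setIdx, RExp.eval, h4k, h1]
    · have hj' : (j : ℕ) ≠ k := by omega
      simp [State.setCell, State.setIdx, hj', h4 j (by omega)]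
  · obtain ⟨h41, h42, h43, h44⟩ := h4
    obtain ⟨h21, h22, h23, h24, h25⟩ := h2
    have hacc : s3.reg .acc = max ‖p‖ 1 := by
      subst h3
      simp only [Fin.is_lt, if_true] at h25
      simp [State.setReg, RExp.eval, h25, EuclideanSpace.norm_eq, pow_two, max_comm]
    refine ⟨fun r hr => ?_, fun a β' ha => ?_, ?_, ?_⟩
    · rw [h41, ← h21 r hr, h3]
      simp [State.setReg, hr]
    · rw [h42 a β' (ha.imp_left And.right), h3]
      exact h22 a β' ha
    · ext j
      rw [State.vec_apply, h43 j j.2, hacc, projBall]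
      simp [div_eq_inv_mul]
    · ext j
      rw [State.vec_apply, h42 _ _ (by simp), h3]
      exact (h23 j j.2).2

end extragradient

/-! ## The gradient estimator -/

/-- The index register of the sampled coordinate of a block. -/
def sampleIdx : Blk → Idx
  | .x => .jx
  | .y => .iy

/-- The sampled sparse vector `g̃_{w₀}(w) - g(w₀)`. -/
noncomputable def State.delta (s : State) (m n : ℕ) : Joint m n :=
  WithLp.toLp 2 fun β => WithLp.toLp 2 fun k =>
    if (k : ℕ) = s.idx (sampleIdx β) then s.reg (.coef β) else 0

section estimator

variable {m n : ℕ} {G : Game m n} {s : State}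

theorem State.delta_apply {β : Blk} {k : Fin (size m n β)} (h : s.idx (sampleIdx β) = k) :
    s.delta m n β = EuclideanSpace.single k (s.reg (.coef β)) := by
  ext j
  simp only [State.delta, h, PiLp.single_apply, Fin.val_inj]

theorem State.delta_congr {s' : State} (hi : s'.idx = s.idx)
    (hr : ∀ β, s'.reg (.coef β) = s.reg (.coef β)) : s'.delta m n = s.delta m n := by
  simp only [State.delta, hi, hr]

theorem Prog.mean_sampleRow (hs : 0 < ∑ i, rowNorm G.A i ^ 2) (i : Idx) (F : State → ℝ) :
    (Prog.sampleRow i).mean G s F =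
      ∑ k, rowNorm G.A k ^ 2 / (∑ k, rowNorm G.A k ^ 2) * F (s.setIdx i k) := by
  rw [Prog.mean, Prog.run, expect_map _ (draw_support_finite _),
    expect_draw (fun _ => sq_nonneg _) hs]

theorem Prog.mean_sampleCol (hs : 0 < ∑ j, colNorm G.A j ^ 2) (j : Idx) (F : State → ℝ) :
    (Prog.sampleCol j).mean G s F =
      ∑ k, colNorm G.A k ^ 2 / (∑ k, colNorm G.A k ^ 2) * F (s.setIdx j k) := by
  rw [Prog.mean, Prog.run, expect_map _ (draw_support_finite _),
    expect_draw (fun _ => sq_nonneg _) hs]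

theorem Prog.mean_sampleInRow {i j : Idx} {k : Fin m} (hk : s.idx i = k) (hs : 0 < rowNorm G.A k)
    (F : State → ℝ) : (Prog.sampleInRow i j).mean G s F =
      ∑ l, |G.A k l| / rowNorm G.A k * F (s.setIdx j l) := by
  rw [Prog.mean, Prog.run, expect_map _ (draw_support_finite _)]
  simp only [hk, coord_val]
  exact expect_draw (fun _ => abs_nonneg _) hs _

theorem Prog.mean_sampleInCol {i j : Idx} {k : Fin n} (hk : s.idx j = k) (hs : 0 < colNorm G.A k)
    (F : State → ℝ) : (Prog.sampleInCol j i).mean G s F =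
      ∑ l, |G.A l k| / colNorm G.A k * F (s.setIdx i l) := by
  rw [Prog.mean, Prog.run, expect_map _ (draw_support_finite _)]
  simp only [hk, coord_val]
  exact expect_draw (fun _ => abs_nonneg _) hs _

/-- The first two moments of the importance sampling estimator. -/
theorem sum_importance {p q : ℕ} (B : Matrix (Fin p) (Fin q) ℝ) (hB : ∀ i, 0 < rowNorm B i)
    (hS : 0 < ∑ i, rowNorm B i ^ 2) (d : Fin p → ℝ) (a : Fin q → ℝ) (c₀ c₁ : ℝ)
    (X : Fin p → Fin q → ℝ) (hX : ∀ i j, X i j = B i j * d i /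
      (rowNorm B i * rowNorm B i / (∑ k, rowNorm B k ^ 2) * (|B i j| / rowNorm B i))) :
    ∑ i, rowNorm B i ^ 2 / (∑ k, rowNorm B k ^ 2) * ∑ j, |B i j| / rowNorm B i *
      (c₀ + (X i j * a j + c₁ * X i j ^ 2)) =
    c₀ + ((∑ i, ∑ j, B i j * d i * a j) + c₁ * ((∑ k, rowNorm B k ^ 2) * ∑ i, d i ^ 2)) := by
  set S := ∑ k, rowNorm B k ^ 2 with hSdef
  have h1 : ∀ i, ∑ j, |B i j| / rowNorm B i = 1 := fun i => by
    rw [← Finset.sum_div]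
    exact div_self (hB i).ne'
  have h2 : ∑ i, rowNorm B i ^ 2 / S = 1 := by
    rw [← Finset.sum_div]
    exact div_self hS.ne'
  -- Where B i j ≠ 0, the probability cancels the denominator of X once, leaving B i j * d i in the
  -- first moment and S d i² |B i j| / rowNorm B i in the second, whose sum over j is S d i². Where
  -- B i j = 0, both sides vanish.
  have h3 : ∀ i j, rowNorm B i ^ 2 / S * (|B i j| / rowNorm B i * (X i j * a j + c₁ * X i j ^ 2)) =
      B i j * d i * a j + c₁ * (S * (d i ^ 2 * (|B i j| / rowNorm B i))) := by
    intro i j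
    have hi := (hB i).ne'
    rw [hX]
    rcases eq_or_ne (B i j) 0 with h | h
    · simp [h]
    · have h' : |B i j| ≠ 0 := abs_ne_zero.2 h
      have hS' := hS.ne'
      field_simp
      linear_combination -(S * d i ^ 2 * c₁) * abs_mul_abs_self (B i j)
  calc _ = ∑ i, (c₀ * (rowNorm B i ^ 2 / S) * (∑ j, |B i j| / rowNorm B i) +
        ∑ j, (B i j * d i * a j + c₁ * (S * (d i ^ 2 * (|B i j| / rowNorm B i))))) := by
        refine Finset.sum_congr rfl fun i _ => ?_
        simp only [← h3, mul_add (|B i _| / rowNorm B i) c₀, Finset.sum_add_distrib, mul_add,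
          Finset.mul_sum]
        congr 1
        exact Finset.sum_congr rfl fun j _ => by ring
    _ = _ := by
        simp only [h1, mul_one, Finset.sum_add_distrib, ← Finset.mul_sum, h2]

/-- Unbiasedness and the second moment in one formula, for test functions affine in δ plus a
multiple of ‖δ‖². The two blocks contribute additively and come from independent samples, so
`sum_importance` applies twice, to A and to its transpose. -/
theorem mean_sampleEstimator (hP : Params G s) (hrow : ∀ i, 0 < rowNorm G.A i)
    (hcol : ∀ j, 0 < colNorm G.A j) (hSr : 0 < ∑ i, rowNorm G.A i ^ 2)
    (hSc : 0 < ∑ j, colNorm G.A j ^ 2) {d : Joint m n}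
    (hd : ∀ β (k : Fin (size m n β)), s.reg (.xiU β) * s.mem .u β k + s.reg (.xiV β) * s.mem .v β k -
      s.mem .center β k = d β k) (a : Joint m n) (c₀ : ℝ) {c₁ : ℝ} :
    sampleEstimator.mean G s (fun s' => c₀ + ⟪s'.delta m n, a⟫ + c₁ * ‖s'.delta m n‖ ^ 2) =
      c₀ + ⟪skewMap G.A d, a⟫ + c₁ * ((∑ i, rowNorm G.A i ^ 2) * ‖d .y‖ ^ 2 +
        (∑ j, colNorm G.A j ^ 2) * ‖d .x‖ ^ 2) := by
  obtain ⟨X, hX⟩ : ∃ X : Fin m → Fin n → ℝ, ∀ i j, X i j = G.A i j * d .y i /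
    (rowNorm G.A i * rowNorm G.A i / (∑ k, rowNorm G.A k ^ 2) * (|G.A i j| / rowNorm G.A i)) :=
    ⟨_, fun _ _ => rfl⟩
  obtain ⟨Y, hY⟩ : ∃ Y : Fin n → Fin m → ℝ, ∀ j i, Y j i = G.A.transpose j i * -d .x j /
    (colNorm G.A j * colNorm G.A j / (∑ k, colNorm G.A k ^ 2) *
      (|G.A.transpose j i| / colNorm G.A j)) := ⟨_, fun _ _ => rfl⟩
  have hfin : ∀ (i : Fin m) (j : Fin n) (j' : Fin n) (i' : Fin m) (s₁ s₂ s₃ : State),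
      s₁ = (((s.setIdx .ix i).setIdx .jx j).setIdx .jy j').setIdx .iy i' →
      s₂ = s₁.setReg (.coef .x) ((RExp.entry .ix .jx * (imGet .y .ix - RExp.cell .center .y .ix) /
        probP .ix .jx : RExp).eval G s₁) →
      s₃ = s₂.setReg (.coef .y) ((0 - RExp.entry .iy .jy * (imGet .x .jy - RExp.cell .center .x .jy) /
        probQ .iy .jy : RExp).eval G s₂) →
      c₀ + ⟪s₃.delta m n, a⟫ + c₁ * ‖s₃.delta m n‖ ^ 2 =
        (c₀ + (X i j * a .x j + c₁ * X i j ^ 2)) + (Y j' i' * a .y i' + c₁ * Y j' i' ^ 2) := by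
    intro i j j' i' s₁ s₂ s₃ h₁ h₂ h₃
    have hx := hd .x j'
    have hy := hd .y i
    have e1 : ∀ x : ℝ, max x (-x) = |x| := fun x => abs_eq_max_neg.symm
    have eX : ∀ s' : State, s'.idx .ix = i → s'.idx .jx = j → s'.reg = s.reg → s'.mem = s.mem →
        (RExp.entry .ix .jx * (imGet .y .ix - RExp.cell .center .y .ix) /
        probP .ix .jx : RExp).eval G s' = X i j := by
      intro s' h1 h2 h3 h4
      simp [RExp.eval, imGet, probP, absEntry, h1, h2, h3, h4, hy, hX, hP.sumRow, e1]
    have eY : ∀ s' : State, s'.idx .iy = i' → s'.idx .jy = j' →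
        (∀ r, r ≠ .coef .x → s'.reg r = s.reg r) → s'.mem = s.mem →
        (0 - RExp.entry .iy .jy * (imGet .x .jy - RExp.cell .center .x .jy) /
        probQ .iy .jy : RExp).eval G s' = Y j' i' := by
      intro s' h1 h2 h3 h4
      simp [RExp.eval, imGet, probQ, absEntry, h1, h2, h3 (.xiU .x), h3 (.xiV .x), h3 .sumCol, h4,
        hx, hY, hP.sumCol, e1, neg_div]
    rw [eX s₁ (by simp [h₁, State.setIdx]) (by simp [h₁, State.setIdx]) (by rw [h₁]; rfl)
      (by rw [h₁]; rfl)] at h₂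
    rw [eY s₂ (by simp [h₁, h₂, State.setIdx, State.setReg])
      (by simp [h₁, h₂, State.setIdx, State.setReg])
      (fun r hr => by simp [h₁, h₂, State.setReg, State.setIdx, hr]) (by rw [h₂, h₁]; rfl)] at h₃
    subst h₃ h₂ h₁
    rw [PiLp.norm_sq_eq_of_L2, PiLp.inner_apply, sum_blk, sum_blk,
      State.delta_apply (β := .x) (k := j) (by simp [State.setReg, State.setIdx, sampleIdx]),
      State.delta_apply (β := .y) (k := i') (by simp [State.setReg, State.setIdx, sampleIdx]),
      EuclideanSpace.inner_single_left, EuclideanSpace.inner_single_left, PiLp.norm_single,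
      PiLp.norm_single]
    simp [State.setReg]
    ring
  simp only [sampleEstimator, Prog.mean_seq, Prog.mean_assign]
  rw [Prog.mean_sampleRow hSr]
  have h1 : ∀ i : Fin m, (s.setIdx .ix i).idx .ix = i := fun i => by simp [State.setIdx]
  have h2 : ∀ (s' : State) (j : Fin n), (s'.setIdx .jy j).idx .jy = j :=
    fun s' i => by simp [State.setIdx]
  simp only [Prog.mean_sampleInRow (h1 _) (hrow _), Prog.mean_sampleCol hSc,
    Prog.mean_sampleInCol (h2 _ _) (hcol _), hfin _ _ _ _ _ _ _ rfl rfl rfl]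
  have hc := fun c => sum_importance G.A.transpose hcol hSc (fun j => -d .x j) (fun i => a .y i) c c₁
    Y hY
  simp only [Matrix.transpose_apply] at hc
  obtain ⟨K, hK⟩ : ∃ K, K = (∑ j, ∑ i, G.A i j * -d .x j * a .y i) +
      c₁ * ((∑ j, colNorm G.A j ^ 2) * ∑ j, (-d .x j) ^ 2) := ⟨_, rfl⟩
  -- Averaging over the column sample shifts any constant by the same K, so the nested row and
  -- column averages separate.
  have hc' : ∀ c, ∑ j, colNorm G.A j ^ 2 / (∑ k, colNorm G.A k ^ 2) * ∑ i, |G.A i j| / colNorm G.A j *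
      (c + (Y j i * a .y i + c₁ * Y j i ^ 2)) = c + K := fun c => (hc c).trans (by rw [hK]; rfl)
  simp only [hc', add_right_comm c₀ _ K]
  rw [sum_importance G.A hrow hSr (fun i => d .y i) (fun j => a .x j) _ c₁ X hX,
    PiLp.inner_apply, sum_blk, EuclideanSpace.norm_sq_eq, EuclideanSpace.norm_sq_eq]
  have e1 : ⟪skewMap G.A d .x, a .x⟫ = ∑ i, ∑ j, G.A i j * d .y i * a .x j := by
    rw [PiLp.inner_apply, Finset.sum_comm]
    refine Finset.sum_congr rfl fun j _ => ?_
    change a .x j * (∑ i, G.A i j * d .y i) = _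
    rw [mul_comm, Finset.sum_mul]
  have e2 : ⟪skewMap G.A d .y, a .y⟫ = ∑ j, ∑ i, G.A i j * -d .x j * a .y i := by
    rw [PiLp.inner_apply, Finset.sum_comm]
    refine Finset.sum_congr rfl fun i _ => ?_
    change a .y i * (-∑ j, G.A i j * d .x j) = _
    rw [mul_comm, ← Finset.sum_neg_distrib, Finset.sum_mul]
    simp
  rw [e1, e2, hK]
  simp only [Real.norm_eq_abs, sq_abs, neg_sq]
  ring

end estimator

/-! ### The inner loop: invariant, noise potential, and the average iterate. -/

section inner

variable {m n : ℕ} {G : Game m n} {s : State}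

theorem Spec.sampleRow (hs : 0 < ∑ i, rowNorm G.A i ^ 2) {i : Idx} {Q : State → Prop}
    (h : ∀ k : Fin m, Q (s.setIdx i k)) : Spec G (.sampleRow i) s 1 Q := by
  intro r hr
  simp only [Prog.run, PMF.mem_support_map_iff] at hr
  obtain ⟨k, hk, rfl⟩ := hr
  obtain ⟨k, rfl, -⟩ := exists_of_mem_support_draw (fun _ => sq_nonneg _) hs hk
  exact ⟨le_rfl, h k⟩

theorem Spec.sampleCol (hs : 0 < ∑ j, colNorm G.A j ^ 2) {j : Idx} {Q : State → Prop}
    (h : ∀ k : Fin n, Q (s.setIdx j k)) : Spec G (.sampleCol j) s 1 Q := by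
  intro r hr
  simp only [Prog.run, PMF.mem_support_map_iff] at hr
  obtain ⟨k, hk, rfl⟩ := hr
  obtain ⟨k, rfl, -⟩ := exists_of_mem_support_draw (fun _ => sq_nonneg _) hs hk
  exact ⟨le_rfl, h k⟩

theorem Spec.sampleInRow {i j : Idx} {k : Fin m} (hk : s.idx i = k) (hs : 0 < rowNorm G.A k)
    {Q : State → Prop} (h : ∀ l : Fin n, Q (s.setIdx j l)) :
    Spec G (.sampleInRow i j) s 1 Q := by
  intro r hr
  simp only [Prog.run, PMF.mem_support_map_iff, hk, coord_val] at hr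
  obtain ⟨l, hl, rfl⟩ := hr
  obtain ⟨l, rfl, -⟩ := exists_of_mem_support_draw (fun _ => abs_nonneg _) hs hl
  exact ⟨le_rfl, h l⟩

theorem Spec.sampleInCol {i j : Idx} {k : Fin n} (hk : s.idx j = k) (hs : 0 < colNorm G.A k)
    {Q : State → Prop} (h : ∀ l : Fin m, Q (s.setIdx i l)) :
    Spec G (.sampleInCol j i) s 1 Q := by
  intro r hr
  simp only [Prog.run, PMF.mem_support_map_iff, hk, coord_val] at hr
  obtain ⟨l, hl, rfl⟩ := hr
  obtain ⟨l, rfl, -⟩ := exists_of_mem_support_draw (fun _ => abs_nonneg _) hs hl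
  exact ⟨le_rfl, h l⟩

/-- The `ℓ₁` norms of the rows and columns are positive. -/
structure Regular (A : Matrix (Fin m) (Fin n) ℝ) : Prop where
  row : ∀ i, 0 < rowNorm A i
  col : ∀ j, 0 < colNorm A j
  sumRow : 0 < ∑ i, rowNorm A i ^ 2
  sumCol : 0 < ∑ j, colNorm A j ^ 2

theorem Regular.of_exists_ne_zero {A : Matrix (Fin m) (Fin n) ℝ} (hm : 0 < m) (hn : 0 < n)
    (hrow : ∀ i, ∃ j, A i j ≠ 0) (hcol : ∀ j, ∃ i, A i j ≠ 0) : Regular A := by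
  have h1 : ∀ i, 0 < rowNorm A i := fun i => by
    obtain ⟨j, hj⟩ := hrow i
    exact Finset.sum_pos' (fun _ _ => abs_nonneg _) ⟨j, Finset.mem_univ _, abs_pos.2 hj⟩
  have h2 : ∀ j, 0 < colNorm A j := fun j => by
    obtain ⟨i, hi⟩ := hcol j
    exact Finset.sum_pos' (fun _ _ => abs_nonneg _) ⟨i, Finset.mem_univ _, abs_pos.2 hi⟩
  have := Fin.pos_iff_nonempty.1 hm
  have := Fin.pos_iff_nonempty.1 hn
  exact ⟨h1, h2, Finset.sum_pos (fun i _ => pow_pos (h1 i) 2) Finset.univ_nonempty,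
    Finset.sum_pos (fun i _ => pow_pos (h2 i) 2) Finset.univ_nonempty⟩

theorem Regular.Lco_pos {A : Matrix (Fin m) (Fin n) ℝ} (h : Regular A) : 0 < Lco A :=
  Real.sqrt_pos.2 (add_pos h.sumRow h.sumCol)

theorem alphaOpt_pos {A : Matrix (Fin m) (Fin n) ℝ} {ε : ℝ} (hε : 0 < ε) : 0 < alphaOpt A ε :=
  lt_max_of_lt_left hε

theorem etaOpt_pos {A : Matrix (Fin m) (Fin n) ℝ} (h : Regular A) {ε : ℝ} (hε : 0 < ε) :
    0 < etaOpt A ε := by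
  have := h.Lco_pos
  have := alphaOpt_pos (A := A) hε
  unfold etaOpt
  positivity

theorem kappaOpt_pos {A : Matrix (Fin m) (Fin n) ℝ} (h : Regular A) {ε : ℝ} (hε : 0 < ε) :
    0 < kappaOpt A ε := by
  have := etaOpt_pos h hε
  have := alphaOpt_pos (A := A) hε
  unfold kappaOpt
  positivity

theorem Spec.sampleEstimator (hA : Regular G.A) :
    Spec G sampleEstimator s 100 fun s' =>
      (∀ r, (∀ β, r ≠ .coef β) → s'.reg r = s.reg r) ∧ s'.mem = s.mem ∧
      ∀ β, ∃ k : Fin (size m n β), s'.idx (sampleIdx β) = k := by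
  refine Spec.mono (Spec.seq (Spec.sampleRow hA.sumRow (Q := fun s' => ∃ i : Fin m, s' = s.setIdx .ix i)
      fun i => ⟨i, rfl⟩) fun s1 ⟨i, h1⟩ =>
    Spec.seq (Spec.sampleInRow (Q := fun s' => ∃ j : Fin n, s' = s1.setIdx .jx j)
      (by simp [h1, State.setIdx]) (hA.row i) fun j => ⟨j, rfl⟩) fun s2 ⟨j, h2⟩ =>
    Spec.seq (Spec.sampleCol hA.sumCol (Q := fun s' => ∃ j : Fin n, s' = s2.setIdx .jy j)
      fun j => ⟨j, rfl⟩) fun s3 ⟨j', h3⟩ =>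
    Spec.seq (Spec.sampleInCol (Q := fun s' => ∃ i : Fin m, s' = s3.setIdx .iy i)
      (by simp [h3, State.setIdx]) (hA.col j') fun i => ⟨i, rfl⟩) fun s4 ⟨i', h4⟩ =>
    Spec.seq (Spec.assign (Q := (· = _)) rfl) fun s5 h5 => Spec.assign ?_)
    (by simp [RExp.cost, imGet, probP, probQ, absEntry]) fun _ h => h
  subst h5 h4 h3 h2 h1
  refine ⟨fun r hr => by simp [State.setReg, State.setIdx, hr], rfl, ?_⟩
  rintro (_ | _)
  · exact ⟨j, by simp [State.setReg, State.setIdx, sampleIdx]⟩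
  · exact ⟨i', by simp [State.setReg, State.setIdx, sampleIdx]⟩

/-- The product of the unit balls. -/
def jointBall (m n : ℕ) : Set (Joint m n) := {u | ∀ β, ‖u β‖ ≤ 1}

/-- The blockwise projection onto the product of the unit balls. -/
noncomputable def projJoint (p : Joint m n) : Joint m n := WithLp.toLp 2 fun β => projBall (p β)

theorem projJoint_mem (p : Joint m n) : projJoint p ∈ jointBall m n := fun β =>
  norm_projBall_le (p β)

theorem inner_sub_projJoint_nonpos (p : Joint m n) {u : Joint m n} (hu : u ∈ jointBall m n) :
    ⟪p - projJoint p, u - projJoint p⟫ ≤ 0 := by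
  rw [PiLp.inner_apply]
  exact Finset.sum_nonpos fun β _ => inner_sub_projBall_nonpos (p β) (u β) (hu β)

/-- The gradient field `g`. -/
noncomputable def Game.grad (G : Game m n) (z : Joint m n) : Joint m n :=
  skewMap G.A z + linTerm G.b G.c

/-- The dense direction `v` of the inner loop with reference point `z`. -/
noncomputable def Game.direction (G : Game m n) (z : Joint m n) : Joint m n :=
  (1 - kappaOpt G.A G.eps) • z - (etaOpt G.A G.eps * kappaOpt G.A G.eps) • G.grad z

/-- A state of the outer loop: `z` is stored in `center`, and `H` in `total`. -/
structure Outer (G : Game m n) (z H : Joint m n) (s : State) : Prop where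
  params : Params G s
  center : s.point m n .center = z
  total : s.point m n .total = H

/-- A state of the inner loop with iterate `w` and sum of iterates `S`. -/
structure Inner (G : Game m n) (z H w S : Joint m n) (s : State) : Prop extends Outer G z H s where
  maintains : ∀ β, Maintains s β (G.direction z β) (w β) (S β)

theorem State.point_congr {s s' : State} {a : Arr} (h : s'.mem a = s.mem a) :
    s'.point m n a = s.point m n a := by
  simp only [State.point, State.vec, h]

theorem Outer.congr {z H : Joint m n} {s s' : State} (h : Outer G z H s)
    (hr : ∀ r : Reg, r.param → s'.reg r = s.reg r) (hc : s'.mem .center = s.mem .center)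
    (ht : s'.mem .total = s.mem .total) : Outer G z H s' :=
  ⟨h.params.congr hr, (State.point_congr hc).trans h.center, (State.point_congr ht).trans h.total⟩

theorem Inner.congr {z H w S : Joint m n} {s s' : State} (h : Inner G z H w S s)
    (hr : ∀ r, (∀ β, r ≠ .coef β) → s'.reg r = s.reg r) (hm : s'.mem = s.mem) :
    Inner G z H w S s' := by
  refine ⟨h.toOuter.congr (fun r hp => hr r ?_) (by rw [hm]) (by rw [hm]), fun β => ?_⟩
  · rintro β rfl
    exact hp
  · obtain ⟨h1, h2, h3, h4, h5, h6, h7⟩ := h.maintains β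
    constructor <;>
      simpa only [hm, hr (.xiU β) (by simp), hr (.xiV β) (by simp), hr (.sigU β) (by simp),
        hr (.sigV β) (by simp), hr (.iota β) (by simp), hr (.nu β) (by simp),
        hr (.normSqV β) (by simp)]

theorem not_maintainer_of_param {r : Reg} (h : r.param) (β : Blk) : ¬ r.maintainer β := by
  cases r <;> first | exact fun h' => h' | exact absurd h id

theorem Outer.of_onlyMaintainer {z H : Joint m n} {s s' : State} {β : Blk} (h : Outer G z H s)
    (h' : OnlyMaintainer β s s') : Outer G z H s' :=
  h.congr (fun r hr => h'.reg r (not_maintainer_of_param hr β))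
    (funext fun β' => h'.mem _ _ (by simp [Arr.maintainer]))
    (funext fun β' => h'.mem _ _ (by simp [Arr.maintainer]))

/-- The iterate that follows `w` if the sampled sparse vector is `δ`. -/
noncomputable def Game.next (G : Game m n) (z w δ : Joint m n) : Joint m n :=
  projJoint (kappaOpt G.A G.eps • w + G.direction z -
    (kappaOpt G.A G.eps * etaOpt G.A G.eps) • δ)

/-- Both coefficients were computed before either block moves, and the first update leaves those of
the second intact. The sample also stays readable afterwards, which lets the next ghost value be a
function of the final state. -/
theorem Spec.updateBlocks (hA : Regular G.A) (hε : 0 < G.eps) {z H w S : Joint m n}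
    (h : Inner G z H w S s) (hi : ∀ β, ∃ k : Fin (size m n β), s.idx (sampleIdx β) = k) :
    Spec G (updateBlock .x .jx ⨟ updateBlock .y .iy) s 300 fun s' =>
      Inner G z H (G.next z w (s.delta m n)) (S + G.next z w (s.delta m n)) s' ∧
      s'.delta m n = s.delta m n := by
  have hκ := kappaOpt_pos hA hε
  obtain ⟨j, hj⟩ := hi .x
  obtain ⟨i, hi⟩ := hi .y
  have hw : ∀ β (k : Fin (size m n β)), s.idx (sampleIdx β) = k →
      G.next z w (s.delta m n) β = projBall (s.reg .kappa • w β + G.direction z β -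
        (s.reg .kappa * s.reg .eta) • EuclideanSpace.single k (s.reg (.coef β))) := by
    intro β k hk
    rw [h.params.kappa, h.params.eta, ← State.delta_apply hk]
    rfl
  refine Spec.mono (Spec.seq ((h.maintains .x).updateBlock (j := .jx) hj (by rwa [h.params.kappa])
    (hw .x j hj)) fun s1 h1 => (((h.maintains .y).congr (by simp) h1.2.reg h1.2.mem).updateBlock (j := .iy) (k := i)
      (w' := G.next z w (s.delta m n) .y) ?_ ?_ ?_).mono le_rfl fun s2 h2 => ?_)
      (by norm_num) fun _ h => h
  · rw [h1.2.idx]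
    exact hi
  · rw [h1.2.reg _ (show ¬ Reg.maintainer .x .kappa from id)]
    rwa [h.params.kappa]
  · rw [h1.2.reg _ (show ¬ Reg.maintainer .x .kappa from id),
      h1.2.reg _ (show ¬ Reg.maintainer .x .eta from id),
      h1.2.reg _ (show ¬ Reg.maintainer .x (.coef .y) from id)]
    exact hw .y i hi
  · refine ⟨⟨(h.toOuter.of_onlyMaintainer h1.2).of_onlyMaintainer h2.2, ?_⟩, ?_⟩
    · rintro (_ | _)
      · exact h1.1.congr (by simp) h2.2.reg h2.2.mem
      · exact h2.1
    · exact State.delta_congr (h2.2.idx.trans h1.2.idx) fun β => (h2.2.reg _ id).trans (h1.2.reg _ id)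

/-- The data of the inner loop: the iterate, the sum of the iterates, the accumulated error of the
estimator, and the accumulated terms of the regret bound that do not depend on the comparator. -/
structure Ghost (m n : ℕ) where
  w : Joint m n
  S : Joint m n
  N : Joint m n
  R : ℝ

/-- The potential of the inner loop. -/
noncomputable def Ghost.potential (η : ℝ) (γ : Ghost m n) : ℝ := γ.R + η ^ 2 / 2 * ‖γ.N‖ ^ 2

/-- The data after one more step with sampled sparse vector `δ`. -/
noncomputable def Ghost.next (G : Game m n) (z : Joint m n) (γ : Ghost m n) (δ : Joint m n) :
    Ghost m n where
  w := G.next z γ.w δ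
  S := γ.S + G.next z γ.w δ
  N := γ.N + skewMap G.A (γ.w - z) - δ
  R := γ.R + etaOpt G.A G.eps ^ 2 / 2 * ‖δ‖ ^ 2 - etaOpt G.A G.eps * ⟪δ, γ.w - z⟫ -
    etaOpt G.A G.eps * alphaOpt G.A G.eps / 2 * (‖γ.w - z‖ ^ 2 / 2)

/-- The invariant of the inner loop. -/
structure InnerInv (G : Game m n) (z H : Joint m n) (t : ℕ) (s : State) (γ : Ghost m n) : Prop
    extends Inner G z H γ.w γ.S s where
  norm_sum_le : ∀ β, ‖γ.S β‖ ≤ t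
  regret : RegretBound (jointBall m n) (skewMap G.A) (etaOpt G.A G.eps) (alphaOpt G.A G.eps) z
    (G.grad z) t γ.w γ.S γ.N γ.R

/-- Used three times: to average regrets exactly, to make E⟨δ, w − z⟩ vanish in the potential, and
to make the outer regret affine in the half step. -/
theorem skewMap_inner_self (A : Matrix (Fin m) (Fin n) ℝ) (d : Joint m n) : ⟪skewMap A d, d⟫ = 0 := by
  rw [PiLp.inner_apply, sum_blk, PiLp.inner_apply, PiLp.inner_apply]
  change (∑ j, d .x j * (∑ i, A i j * d .y i)) + (∑ i, d .y i * (-∑ j, A i j * d .x j)) = 0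
  simp only [Finset.mul_sum, mul_neg, Finset.sum_neg_distrib]
  rw [Finset.sum_comm, add_neg_eq_zero]
  exact Finset.sum_congr rfl fun i _ => Finset.sum_congr rfl fun j _ => by ring

/-- Cauchy–Schwarz in each row, followed by ‖·‖₂ ≤ ‖·‖₁. -/
theorem sum_mul_sq_le {p q : ℕ} (B : Matrix (Fin p) (Fin q) ℝ) (x : Fin q → ℝ) :
    ∑ i, (∑ j, B i j * x j) ^ 2 ≤ (∑ i, rowNorm B i ^ 2) * ∑ j, x j ^ 2 := by
  rw [Finset.sum_mul]
  refine Finset.sum_le_sum fun i _ => (Finset.sum_mul_sq_le_sq_mul_sq _ _ _).trans ?_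
  refine mul_le_mul_of_nonneg_right ?_ (Finset.sum_nonneg fun _ _ => sq_nonneg _)
  simp only [← sq_abs (B i _)]
  exact Finset.sum_sq_le_sq_sum_of_nonneg fun _ _ => abs_nonneg _

theorem norm_skewMap_le (A : Matrix (Fin m) (Fin n) ℝ) (d : Joint m n) :
    ‖skewMap A d‖ ≤ Lco A * ‖d‖ := by
  refine le_of_sq_le_sq ?_ (mul_nonneg (Real.sqrt_nonneg _) (norm_nonneg _))
  rw [mul_pow, Lco_sq, PiLp.norm_sq_eq_of_L2, PiLp.norm_sq_eq_of_L2, sum_blk, sum_blk,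
    EuclideanSpace.norm_sq_eq, EuclideanSpace.norm_sq_eq, EuclideanSpace.norm_sq_eq,
    EuclideanSpace.norm_sq_eq]
  have h1 := sum_mul_sq_le A (fun j => d .x j)
  have h2 := sum_mul_sq_le A.transpose (fun i => d .y i)
  have h3 : ∑ j, rowNorm A.transpose j ^ 2 = ∑ j, colNorm A j ^ 2 := rfl
  rw [h3] at h2
  change (∑ j, ‖∑ i, A i j * d .y i‖ ^ 2) + (∑ i, ‖-∑ j, A i j * d .x j‖ ^ 2) ≤ _
  simp only [Real.norm_eq_abs, sq_abs, neg_sq]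
  have h4 : 0 ≤ (∑ i, rowNorm A i ^ 2) * ∑ i, d .y i ^ 2 := by positivity
  have h5 : 0 ≤ (∑ i, colNorm A i ^ 2) * ∑ j, d .x j ^ 2 := by positivity
  simp only [Matrix.transpose_apply] at h2
  calc _ ≤ (∑ j, colNorm A j ^ 2) * (∑ i, d .y i ^ 2) + (∑ i, rowNorm A i ^ 2) * ∑ j, d .x j ^ 2 :=
        add_le_add h2 h1
    _ ≤ _ := by
        rw [add_mul, mul_add, mul_add]
        linarith

theorem InnerInv.step (hA : Regular G.A) (hε : 0 < G.eps) {z H : Joint m n} {t : ℕ} {γ : Ghost m n}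
    (h : InnerInv G z H t s γ) :
    Spec G (sampleEstimator ⨟ updateBlock .x .jx ⨟ updateBlock .y .iy) s 400 fun s' =>
      InnerInv G z H (t + 1) s' (γ.next G z (s'.delta m n)) := by
  refine Spec.mono (Spec.seq (Spec.sampleEstimator hA) fun s1 h1 =>
    (Spec.updateBlocks hA hε (h.toInner.congr h1.1 h1.2.1) h1.2.2).mono le_rfl fun s2 h2 => ?_)
    (by norm_num) fun _ h => h
  rw [h2.2]
  refine ⟨h2.1, fun β => ?_, ?_⟩
  · push_cast
    exact (norm_add_le _ _).trans (add_le_add (h.norm_sum_le β) (projJoint_mem _ β))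
  · exact h.regret.step (etaOpt_pos hA hε).le (alphaOpt_pos hε).le rfl
      fun u hu => inner_sub_projJoint_nonpos _ hu

/-- With d = w − z and D = M d, the mean of δ is D. The cross terms with N cancel, ⟨D, d⟩ = 0, and
the expected increase is at most η² E‖δ‖² − (ηα/4)‖d‖² ≤ (1/20 − 1/4) ηα‖d‖² ≤ 0. -/
theorem InnerInv.mean_potential_le (hA : Regular G.A) (hε : 0 < G.eps) {z H : Joint m n} {t : ℕ}
    {γ : Ghost m n} (h : InnerInv G z H t s γ) :
    (sampleEstimator ⨟ updateBlock .x .jx ⨟ updateBlock .y .iy).mean G s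
      (fun s' => (γ.next G z (s'.delta m n)).potential (etaOpt G.A G.eps)) ≤
        γ.potential (etaOpt G.A G.eps) := by
  set η := etaOpt G.A G.eps with hη
  set α := alphaOpt G.A G.eps with hα
  have hη0 : 0 < η := etaOpt_pos hA hε
  have hL := hA.Lco_pos
  rw [Prog.mean_seq]
  -- The block updates do not change δ, so the expectation reduces to the sampling phase.
  refine (Prog.mean_mono (Spec.sampleEstimator hA)
    (F' := fun s' => (γ.next G z (s'.delta m n)).potential η) fun s1 h1 =>
    Prog.mean_le (Spec.updateBlocks hA hε (h.toInner.congr h1.1 h1.2.1) h1.2.2)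
      fun s2 h2 => by rw [h2.2]).trans ?_
  set d := γ.w - z with hd
  set D := skewMap G.A d with hD
  -- The coefficient η² of ‖δ‖² consists of two halves: one from the one-step regret, one from ‖N +
  -- D − δ‖².
  have e : ∀ δ : Joint m n, (γ.next G z δ).potential η =
      (γ.R - η * α / 2 * (‖d‖ ^ 2 / 2) + η ^ 2 / 2 * ‖γ.N + D‖ ^ 2) +
        ⟪δ, -(η • d) - η ^ 2 • (γ.N + D)⟫ + η ^ 2 * ‖δ‖ ^ 2 := by
    intro δ
    simp only [Ghost.potential, Ghost.next, ← hη, ← hα, ← hd, ← hD]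
    rw [norm_sub_sq_real (γ.N + D), inner_sub_right δ (-(η • d)), inner_neg_right, real_inner_smul_right,
      real_inner_smul_right, real_inner_comm δ]
    ring
  simp only [e]
  rw [mean_sampleEstimator h.params hA.row hA.col hA.sumRow hA.sumCol (d := d) fun β k => ?_]
  · rw [← hD, inner_sub_right, inner_neg_right, real_inner_smul_right, real_inner_smul_right,
      hD, skewMap_inner_self, ← hD, inner_add_right, real_inner_self_eq_norm_sq, norm_add_sq_real,
      real_inner_comm γ.N D, Ghost.potential]
    have h1 : (∑ i, rowNorm G.A i ^ 2) * ‖d .y‖ ^ 2 + (∑ j, colNorm G.A j ^ 2) * ‖d .x‖ ^ 2 ≤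
        Lco G.A ^ 2 * ‖d‖ ^ 2 := by
      rw [Lco_sq, PiLp.norm_sq_eq_of_L2 _ d, sum_blk, add_mul, mul_add, mul_add]
      have h4 : 0 ≤ (∑ i, rowNorm G.A i ^ 2) * ‖d .x‖ ^ 2 := by positivity
      have h5 : 0 ≤ (∑ i, colNorm G.A i ^ 2) * ‖d .y‖ ^ 2 := by positivity
      linarith
    have h2 : η ^ 2 * (Lco G.A ^ 2 * ‖d‖ ^ 2) = η * α / 20 * ‖d‖ ^ 2 := by
      have : η * Lco G.A ^ 2 = α / 20 := by
        rw [hη, etaOpt, ← hα]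
        field_simp
      linear_combination η * ‖d‖ ^ 2 * this
    have h3 := mul_le_mul_of_nonneg_left h1 (sq_nonneg η)
    have h4 : 0 ≤ η * α * ‖d‖ ^ 2 := by
      have := alphaOpt_pos (A := G.A) hε
      positivity
    have h5 : 0 ≤ η ^ 2 * ‖D‖ ^ 2 := by positivity
    linarith
  · rw [(h.maintains β).w_eq, hd, ← h.center]
    rfl

theorem Spec.store_div {a : Arr} {β : Blk} {e ex : RExp} {d N : ℕ} {f : Vect d} {r : Reg}
    (he : e.eval G s = d) (hr : s.reg r = N)
    (hf : ∀ (k : Fin d) (s' : State), s'.reg = s.reg →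
      (∀ a' β', a' ≠ a → s'.mem a' β' = s.mem a' β') → s'.idx .l = k → ex.eval G s' = f k) :
    Spec G (.loop .l e (.store a β .l (ex / r))) s (d * (ex.cost + 4) + e.cost + 1) fun s' =>
      s'.reg = s.reg ∧ (∀ a' β', (a' = a → β' ≠ β) → s'.mem a' β' = s.mem a' β') ∧
      s'.vec a β d = (N : ℝ)⁻¹ • f := by
  refine (Spec.fill ((N : ℝ)⁻¹ • f) he fun k s' h1 h2 h3 => ?_).mono (by simp [RExp.cost])
    fun s' h => ⟨h.1, h.2.1, by ext k; exact h.2.2 k⟩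
  rw [RExp.eval_div', hf k s' h1 (fun a' β' h => h2 a' β' fun h' => absurd h' h) h3, RExp.eval_reg,
    h1, hr, PiLp.smul_apply, smul_eq_mul, div_eq_inv_mul]

theorem point_eq {s : State} {a : Arr} {p : Joint m n} (hx : s.vec a .x n = p .x)
    (hy : s.vec a .y m = p .y) : s.point m n a = p := by
  ext (_ | _) k
  · exact congrArg (fun v : Vect n => v k) hx
  · exact congrArg (fun v : Vect m => v k) hy

/-- The state after the inner loop. -/
structure HalfStep (G : Game m n) (z H : Joint m n) (s : State) : Prop extends Outer G z H s where
  half_mem : s.point m n .half ∈ jointBall m n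

theorem Spec.storeHalf {z H w S : Joint m n} (h : Inner G z H w S s)
    (hS : ∀ β, ‖S β‖ ≤ numInner G.A G.eps) :
    Spec G (.loop .l .cols (.store .half .x .l (imGetSum .x .l / Reg.numT)) ⨟
      .loop .l .rows (.store .half .y .l (imGetSum .y .l / Reg.numT))) s (20 * (n + m) + 10) fun s' =>
      HalfStep G z H s' ∧ s'.point m n .half = (numInner G.A G.eps : ℝ)⁻¹ • S := by
  refine Spec.mono (Spec.seq (Spec.store_div (f := S .x) (d := n) rfl h.params.numT
    fun k s' h1 h2 h3 => ?_) fun s1 h1 =>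
    (Spec.store_div (f := S .y) (d := m) rfl (by rw [h1.1, h.params.numT])
      fun k s' h4 h5 h6 => ?_).mono le_rfl fun s2 h2 => ?_)
    (by simp [RExp.cost, imGetSum]; omega) fun _ h => h
  · rw [← (h.maintains .x).sum_eq k]
    simp [RExp.eval, imGetSum, h1, h2, h3]
  · rw [← (h.maintains .y).sum_eq k]
    simp [RExp.eval, imGetSum, h4, h5, h6, h1.1, h1.2.1]
  · have hp : s2.point m n .half = (numInner G.A G.eps : ℝ)⁻¹ • S :=
      point_eq ((State.vec_congr (h2.2.1 _ _ (by simp)) n).trans h1.2.2) h2.2.2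
    refine ⟨⟨h.toOuter.congr (fun r _ => by rw [h2.1, h1.1]) ?_ ?_, ?_⟩, hp⟩
    · exact funext fun β => (h2.2.1 _ _ (by simp)).trans (h1.2.1 _ _ (by simp))
    · exact funext fun β => (h2.2.1 _ _ (by simp)).trans (h1.2.1 _ _ (by simp))
    · rw [hp]
      intro β
      rw [PiLp.smul_apply, norm_smul, norm_inv, Real.norm_natCast]
      exact inv_mul_le_one_of_le₀ (hS β) (Nat.cast_nonneg _)

/-- The expression for the direction of the inner loop. -/
def directionExp (β : Blk) : RExp :=
  (1 - .reg .kappa) * .cell .center β .l - .reg .eta * .reg .kappa * .cell .grad β .l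

/-- The specifications are nested as postconditions of one another, so that the same statement
serves both the sequential cost rule and the sequential expectation rule. -/
theorem Spec.initInner {z H : Joint m n} (h : Outer G z H s) :
    Spec G (BallGame.gradientOf .center) s (4 * n + 4 * m + 20 * nnz G.A + 20) fun s' =>
      Spec G (BallGame.imInit .x .center (directionExp .x)) s' (n * 50 + 30) fun s' =>
      Spec G (BallGame.imInit .y .center (directionExp .y)) s' (m * 50 + 30) fun s' =>
      InnerInv G z H 0 s' ⟨z, 0, 0, 0⟩ := by
  refine (Spec.gradientOf (by simp)).mono le_rfl fun s1 h1 => ?_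
  have o1 : Outer G z H s1 := h.congr (fun r _ => by rw [h1.1]) (h1.2.1 _ (by simp)) (h1.2.1 _ (by simp))
  have hg : s1.point m n .grad = G.grad z := by rw [h1.2.2, h.center]; rfl
  refine (Spec.imInit (β := .x) (x := z .x) (v := G.direction z .x) (by simp [Arr.maintainer])
    (fun k => by rw [← o1.center]; rfl) fun k s' hr hm hl => ?_).mono (by simp [RExp.cost, directionExp, size]; omega)
    fun s2 h2 => ?_
  · have e1 : s1.mem .grad .x k = G.grad z .x k := by rw [← hg]; rfl
    have e2 : s1.mem .center .x k = z .x k := by rw [← o1.center]; rfl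
    simp [directionExp, RExp.eval, hl, hm .center .x (by simp [Arr.maintainer]), hm .grad .x (by simp [Arr.maintainer]),
      hr .kappa id, hr .eta id, o1.params.kappa, o1.params.eta, e1, e2, Game.direction]
  have o2 : Outer G z H s2 := o1.congr (fun r hr => h2.1 r (not_maintainer_of_param hr _))
    (funext fun β => h2.2.1 _ _ (by simp [Arr.maintainer]))
    (funext fun β => h2.2.1 _ _ (by simp [Arr.maintainer]))
  refine (Spec.imInit (β := .y) (x := z .y) (v := G.direction z .y) (by simp [Arr.maintainer])
    (fun k => by rw [← o2.center]; rfl) fun k s' hr hm hl => ?_).mono (by simp [RExp.cost, directionExp, size]; omega)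
    fun s3 h3 => ?_
  · have e1 : s2.mem .grad .y k = G.grad z .y k := by
      rw [h2.2.1 _ _ (by simp [Arr.maintainer]), ← hg]; rfl
    have e2 : s2.mem .center .y k = z .y k := by rw [← o2.center]; rfl
    simp [directionExp, RExp.eval, hl, hm .center .y (by simp [Arr.maintainer]), hm .grad .y (by simp [Arr.maintainer]),
      hr .kappa id, hr .eta id, o2.params.kappa, o2.params.eta, e1, e2, Game.direction]
  have o3 : Outer G z H s3 := o2.congr (fun r hr => h3.1 r (not_maintainer_of_param hr _))
    (funext fun β => h3.2.1 _ _ (by simp [Arr.maintainer]))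
    (funext fun β => h3.2.1 _ _ (by simp [Arr.maintainer]))
  refine ⟨⟨o3, ?_⟩, by simp, RegretBound.zero⟩
  rintro (_ | _)
  · exact h2.2.2.congr (by simp) h3.1 h3.2.1
  · exact h3.2.2

end inner

/-! ### The inner loop as a proximal oracle, and the extragradient loop around it. -/

section outer

variable {m n : ℕ} {G : Game m n} {s : State}

theorem InnerInv.setIdx {z H : Joint m n} {t : ℕ} {γ : Ghost m n} (h : InnerInv G z H t s γ)
    (l : Idx) (k : ℕ) : InnerInv G z H t (s.setIdx l k) γ :=
  ⟨h.toInner.congr (fun _ _ => rfl) rfl, h.norm_sum_le, h.regret⟩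

theorem ceil_numT (h : Params G s) : ⌈(RExp.reg .numT).eval G s⌉₊ = numInner G.A G.eps := by
  rw [RExp.eval_reg, h.numT, Nat.ceil_natCast]

theorem Spec.innerLoop (hA : Regular G.A) (hε : 0 < G.eps) {z H : Joint m n} (h : Outer G z H s) :
    Spec G innerLoop s (1000 * (m + n + nnz G.A + numInner G.A G.eps + 1)) (HalfStep G z H) := by
  have h3 : ∀ s', InnerInv G z H 0 s' ⟨z, 0, 0, 0⟩ → Spec G (Prog.loop .t (.reg .numT)
      (BallGame.sampleEstimator ⨟ updateBlock .x .jx ⨟ updateBlock .y .iy)) s'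
      (numInner G.A G.eps * 401 + 2) fun s' => ∃ γ, InnerInv G z H (numInner G.A G.eps) s' γ :=
    fun s' h' => Spec.loop (fun t s' => ∃ γ, InnerInv G z H t s' γ) (ceil_numT h'.params) ⟨_, h'⟩
      fun t _ s' ⟨_, hγ⟩ => ((hγ.setIdx .t t).step hA hε).mono le_rfl fun _ h => ⟨_, h⟩
  have h4 : ∀ s', (∃ γ, InnerInv G z H (numInner G.A G.eps) s' γ) → Spec G
      (.loop .l .cols (.store .half .x .l (imGetSum .x .l / Reg.numT)) ⨟
      .loop .l .rows (.store .half .y .l (imGetSum .y .l / Reg.numT))) s' (20 * (n + m) + 10)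
      (HalfStep G z H) := by
    rintro s' ⟨γ, hγ⟩
    have h5 := Spec.storeHalf hγ.toInner hγ.norm_sum_le
    exact h5.mono le_rfl fun _ h => h.1
  exact Spec.mono (Spec.seq (Spec.initInner h) fun _ h1 => Spec.seq h1 fun _ h2 => Spec.seq h2
    fun s3 h => Spec.seq (h3 s3 h) h4) (by omega) fun _ h => h

/-- The inner loop is a relaxed proximal oracle in expectation. -/
theorem mean_innerLoop_le (hA : Regular G.A) (hε : 0 < G.eps) {z H : Joint m n} (h : Outer G z H s)
    {F : State → ℝ} {R : ℝ} (hF : ∀ s' B, HalfStep G z H s' →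
      (∀ u ∈ jointBall m n, ⟪G.grad (s'.point m n .half), s'.point m n .half - u⟫ -
        alphaOpt G.A G.eps * (‖u - z‖ ^ 2 / 2) ≤ B) → F s' ≤ R + B) :
    innerLoop.mean G s F ≤ R := by
  set η := etaOpt G.A G.eps with hη
  set T := numInner G.A G.eps with hT
  have hη0 : 0 < η := etaOpt_pos hA hε
  unfold innerLoop
  rw [Prog.mean_seq]
  refine Prog.mean_le (Spec.initInner h) fun s1 h1 => ?_
  rw [Prog.mean_seq]
  refine Prog.mean_le h1 fun s2 h2 => ?_
  rw [Prog.mean_seq]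
  refine Prog.mean_le h2 fun s3 h3 => ?_
  rw [Prog.mean_seq]
  -- The factor matches `RegretBound.final`. The noise and the accumulated terms start at zero, so
  -- the initial value is R.
  refine (Prog.mean_loop_le (InnerInv G z H) (fun γ => R + (η * T)⁻¹ * γ.potential η)
    (ceil_numT h3.params) h3 (fun t ht s' γ hγ => ⟨fun s'' => γ.next G z (s''.delta m n),
      ⟨_, (hγ.setIdx .t t).step hA hε⟩, ?_⟩) fun s' γ hγ => ?_).trans_eq (by simp [Ghost.potential])
  · have h4 := (hγ.setIdx .t t).mean_potential_le hA hε
    rw [Prog.mean_const_add_mul]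
    gcongr
  · have h5 := Spec.storeHalf hγ.toInner hγ.norm_sum_le
    refine Prog.mean_le h5 fun s4 h4 => ?_
    refine hF s4 _ h4.1 fun u hu => ?_
    rw [h4.2]
    exact hγ.regret.final (alphaOpt_pos hε) hA.Lco_pos rfl (norm_skewMap_le G.A)
      (skewMap_inner_self G.A) (Nat.le_ceil _) rfl hu

/-- A state of the outer loop after `k` steps, with accumulated regret `R`. -/
structure OuterInv (G : Game m n) (k : ℕ) (s : State) (z H : Joint m n) (R : ℝ) : Prop
    extends Outer G z H s where
  norm_sum_le : ∀ β, ‖H β‖ ≤ k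
  regret : ∀ u ∈ jointBall m n, ⟪linTerm G.b G.c, H - (k : ℝ) • u⟫ - ⟪skewMap G.A H, u⟫ ≤
    alphaOpt G.A G.eps * (‖u‖ ^ 2 / 2 - ‖u - z‖ ^ 2 / 2) + R

/-- The part of an outer step that follows the inner loop. -/
def outerTail : Prog := gradientOf .half ⨟ extragradient .x ⨟ extragradient .y

theorem Spec.outerTail {z H h : Joint m n} (hs : HalfStep G z H s) (hh : s.point m n .half = h) :
    Spec G outerTail s (100 * (m + n + nnz G.A + 1)) fun s' =>
      Outer G (projJoint (z - (alphaOpt G.A G.eps)⁻¹ • G.grad h)) (H + h) s' ∧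
      s'.point m n .half = h := by
  have hvec : ∀ {s : State} {a : Arr} {p : Joint m n} (β : Blk), s.point m n a = p →
      s.vec a β (size m n β) = p β := by
    rintro s a _ β rfl
    rfl
  refine Spec.mono (Spec.seq (Spec.gradientOf (by simp)) fun s1 h1 =>
    Spec.seq (Spec.extragradient (β := .x) (d := n) rfl (z := z .x) (g := G.grad h .x) (h := h .x)
      (H := H .x) ?_ ?_ ?_ ?_) fun s2 h2 =>
    (Spec.extragradient (β := .y) (d := m) rfl (z := z .y) (g := G.grad h .y) (h := h .y)
      (H := H .y) ?_ ?_ ?_ ?_).mono le_rfl fun s3 h3 => ?_)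
    (by omega) fun _ h => h
  all_goals
    have hg : s1.point m n .grad = G.grad h := by rw [h1.2.2, hh]; rfl
    have hc : s1.point m n .center = z := (State.point_congr (h1.2.1 _ (by simp))).trans hs.center
    have ht : s1.point m n .total = H := (State.point_congr (h1.2.1 _ (by simp))).trans hs.total
    have hh' : s1.point m n .half = h := (State.point_congr (h1.2.1 _ (by simp))).trans hh
  · exact hvec .x hc
  · exact hvec .x hg
  · exact hvec .x hh'
  · exact hvec .x ht
  · exact (State.vec_congr (h2.2.1 _ _ (by simp)) m).trans (hvec .y hc)
  · exact (State.vec_congr (h2.2.1 _ _ (by simp)) m).trans (hvec .y hg)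
  · exact (State.vec_congr (h2.2.1 _ _ (by simp)) m).trans (hvec .y hh')
  · exact (State.vec_congr (h2.2.1 _ _ (by simp)) m).trans (hvec .y ht)
  · have hα1 : s1.reg .alpha = alphaOpt G.A G.eps := by rw [h1.1, hs.params.alpha]
    have hα2 : s2.reg .alpha = alphaOpt G.A G.eps := by rw [h2.1 _ (by simp), hα1]
    rw [hα1] at h2
    rw [hα2] at h3
    refine ⟨⟨hs.params.congr fun r hr => ?_, ?_, ?_⟩, ?_⟩
    · have : r ≠ .acc := by
        rintro rfl
        exact hr
      rw [h3.1 r this, h2.1 r this, h1.1]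
    · exact point_eq ((State.vec_congr (h3.2.1 _ _ (by simp)) n).trans h2.2.2.1) h3.2.2.1
    · exact point_eq ((State.vec_congr (h3.2.1 _ _ (by simp)) n).trans h2.2.2.2) h3.2.2.2
    · rw [← hh']
      exact (State.point_congr (funext fun β => h3.2.1 _ _ (by simp))).trans
        (State.point_congr (funext fun β => h2.2.1 _ _ (by simp)))

/-- By skewness ⟨g(h), h − u⟩ = ⟨linTerm, h − u⟩ − ⟨M h, u⟩ is affine in h, so the regret of all
half steps depends only on their sum H, and the distance terms telescope. -/
theorem OuterInv.step (hε : 0 < G.eps) {k : ℕ} {z H h : Joint m n} {R : ℝ}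
    {s' : State} (hs : OuterInv G k s z H R) (hh : h ∈ jointBall m n) {z' : Joint m n}
    (hz' : z' = projJoint (z - (alphaOpt G.A G.eps)⁻¹ • G.grad h)) (hs' : Outer G z' (H + h) s') :
    OuterInv G (k + 1) s' z' (H + h)
      (R + (⟪G.grad h, h - z'⟫ - alphaOpt G.A G.eps * (‖z' - z‖ ^ 2 / 2))) := by
  refine ⟨hs', fun β => ?_, fun u hu => ?_⟩
  · push_cast
    exact (norm_add_le _ _).trans (add_le_add (hs.norm_sum_le β) (hh β))
  · have h1 := extragradient_step (Z := jointBall m n) (α := alphaOpt G.A G.eps) (alphaOpt_pos hε)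
      (z := z) (z' := z') (g := G.grad h) (p := h)
      (fun u hu => by rw [hz']; exact inner_sub_projJoint_nonpos _ hu) hu
    have h2 := hs.regret u hu
    have e1 : H + h - ((k + 1 : ℕ) : ℝ) • u = (H - (k : ℝ) • u) + (h - u) := by
      push_cast
      rw [add_smul, one_smul]
      abel
    have e2 : ⟪G.grad h, h - u⟫ = ⟪linTerm G.b G.c, h - u⟫ - ⟪skewMap G.A h, u⟫ := by
      rw [Game.grad, inner_add_left, inner_sub_right (skewMap G.A h) h u, skewMap_inner_self]
      ring
    rw [e1, map_add, inner_add_right, inner_add_left]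
    linarith

/-- The body of the outer loop. -/
def outerBody : Prog := innerLoop ⨟ outerTail

theorem OuterInv.setIdx {k : ℕ} {z H : Joint m n} {R : ℝ} (h : OuterInv G k s z H R)
    (l : Idx) (t : ℕ) : OuterInv G k (s.setIdx l t) z H R :=
  ⟨h.toOuter.congr (fun _ _ => rfl) rfl rfl, h.norm_sum_le, h.regret⟩

/-- The regret after an outer step that starts from `z` and ends in the state `s`. -/
noncomputable def Game.nextRegret (G : Game m n) (z : Joint m n) (R : ℝ) (s : State) : ℝ :=
  R + (⟪G.grad (s.point m n .half), s.point m n .half - s.point m n .center⟫ -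
    alphaOpt G.A G.eps * (‖s.point m n .center - z‖ ^ 2 / 2))

theorem Spec.outerBody (hA : Regular G.A) (hε : 0 < G.eps) {k : ℕ} {z H : Joint m n} {R : ℝ}
    (h : OuterInv G k s z H R) :
    Spec G outerBody s (1100 * (m + n + nnz G.A + numInner G.A G.eps + 1)) fun s' =>
      OuterInv G (k + 1) s' (s'.point m n .center) (s'.point m n .total) (G.nextRegret z R s') := by
  refine Spec.mono (Spec.seq (Spec.innerLoop hA hε h.toOuter) fun s1 h1 =>
    (Spec.outerTail h1 rfl).mono le_rfl fun s2 h2 => ?_) (by omega) fun _ h => h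
  rw [Game.nextRegret, h2.1.center, h2.1.total, h2.2]
  exact h.step hε h1.half_mem rfl h2.1

theorem mean_nextRegret_le (hA : Regular G.A) (hε : 0 < G.eps) {z H : Joint m n} (R : ℝ)
    (h : Outer G z H s) : outerBody.mean G s (G.nextRegret z R) ≤ R := by
  unfold outerBody
  rw [Prog.mean_seq]
  refine mean_innerLoop_le hA hε h fun s1 B h1 hB => ?_
  refine Prog.mean_le (Spec.outerTail h1 rfl) fun s2 h2 => ?_
  rw [Game.nextRegret, h2.1.center, h2.2]
  -- The oracle bound is applied at u = z', the new centre, which lies in the balls because it is a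
  -- projection.
  exact add_le_add_right (hB _ (projJoint_mem _)) R

/-! ## The duality gap -/

/-- For u = (x', y') the terms pʸᵀ A pˣ of the two blocks cancel, and ⟨g(p), p − u⟩ becomes f(pˣ,
y') − f(x', pʸ). -/
theorem gap_le {A : Matrix (Fin m) (Fin n) ℝ} {b : Fin n → ℝ} {c : Fin m → ℝ} {p : Joint m n} {B : ℝ}
    (h : ∀ u ∈ jointBall m n, ⟪skewMap A p + linTerm b c, p - u⟫ ≤ B) :
    gap A b c (p .x, p .y) ≤ B := by
  have h1 : ∀ (x : unitBall n) (y : unitBall m),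
      payoff A b c (p .x) y ≤ B + payoff A b c x (p .y) := by
    intro x y
    have hu := h (WithLp.toLp 2 fun β => match β with | .x => x.1 | .y => y.1) (by
      rintro (_ | _)
      · exact mem_closedBall_zero_iff.1 x.2
      · exact mem_closedBall_zero_iff.1 y.2)
    rw [PiLp.inner_apply, sum_blk, PiLp.inner_apply, PiLp.inner_apply] at hu
    change (∑ j, (p .x j - x.1 j) * ((∑ i, A i j * p .y i) + b j)) +
      (∑ i, (p .y i - y.1 i) * (-(∑ j, A i j * p .x j) + c i)) ≤ B at hu
    have e : ∀ (f : Fin n → ℝ) (g : Fin m → ℝ),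
        ∑ j, f j * (∑ i, A i j * g i) = ∑ i, ∑ j, g i * A i j * f j := by
      intro f g
      simp only [Finset.mul_sum]
      rw [Finset.sum_comm]
      exact Finset.sum_congr rfl fun _ _ => Finset.sum_congr rfl fun _ _ => by ring
    have e' : ∀ (f : Fin n → ℝ) (g : Fin m → ℝ),
        ∑ i, g i * (∑ j, A i j * f j) = ∑ i, ∑ j, g i * A i j * f j := by
      intro f g
      simp only [Finset.mul_sum, mul_assoc]
    simp only [sub_mul, mul_add, mul_neg, Finset.sum_sub_distrib, Finset.sum_add_distrib,
      Finset.sum_neg_distrib, e, e'] at hu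
    simp only [payoff]
    simp only [mul_comm (b _), mul_comm (c _)]
    linarith
  have : Nonempty (unitBall n) := ⟨⟨0, by simp [unitBall]⟩⟩
  have : Nonempty (unitBall m) := ⟨⟨0, by simp [unitBall]⟩⟩
  have h2 : (⨆ y : unitBall m, payoff A b c (p .x) y) - B ≤ ⨅ x : unitBall n, payoff A b c x (p .y) :=
    le_ciInf fun x => sub_le_iff_le_add'.2 (ciSup_le fun y => h1 x y)
  rw [gap]
  linarith

theorem OuterInv.gap_le {k : ℕ} (hk : 0 < k) (hε : 0 < G.eps) {z H : Joint m n} {R : ℝ}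
    (h : OuterInv G k s z H R) {p : Joint m n} (hp : p = (k : ℝ)⁻¹ • H) :
    gap G.A G.b G.c (p .x, p .y) ≤ (k : ℝ)⁻¹ * (alphaOpt G.A G.eps + R) := by
  refine BallGame.gap_le fun u hu => ?_
  have hk' : (0 : ℝ) < k := Nat.cast_pos.2 hk
  have h1 := h.regret u hu
  have h2 : H = (k : ℝ) • p := by rw [hp, smul_inv_smul₀ hk'.ne']
  rw [h2, ← smul_sub, map_smul, real_inner_smul_left, real_inner_smul_right] at h1
  rw [inner_add_left, inner_sub_right (skewMap G.A p) p u, skewMap_inner_self, inv_mul_eq_div,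
    le_div_iff₀' hk']
  -- Two unit balls, each contributing at most 1; hence V_0(u) ≤ 1 for the starting point 0.
  have h3 : ‖u‖ ^ 2 ≤ 2 := by
    rw [PiLp.norm_sq_eq_of_L2, sum_blk]
    have := pow_le_one₀ (n := 2) (norm_nonneg _) (hu .x)
    have := pow_le_one₀ (n := 2) (norm_nonneg _) (hu .y)
    linarith
  have h4 : 0 ≤ ‖u - z‖ ^ 2 := sq_nonneg _
  have h5 : alphaOpt G.A G.eps * (‖u‖ ^ 2 / 2 - ‖u - z‖ ^ 2 / 2) ≤ alphaOpt G.A G.eps * 1 :=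
    mul_le_mul_of_nonneg_left (by linarith) (alphaOpt_pos hε).le
  linarith

/-! ## The whole method -/

theorem Spec.clear {a : Arr} {β : Blk} {d : ℕ} (hd : d = size m n β) :
    Spec G (clear a β) s (d * 3 + 2) fun s' => s'.reg = s.reg ∧
      (∀ a' β', (a' = a → β' ≠ β) → s'.mem a' β' = s.mem a' β') ∧ s'.vec a β d = 0 :=
  (Spec.fill (d := d) (fun _ => 0) (by rw [eval_dim, hd]) fun k s' _ _ _ => by simp).mono (by simp)
    fun s' h => ⟨h.1, h.2.1, by ext k; exact h.2.2 k⟩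

/-- The initialization of the method. -/
theorem Spec.initOuter :
    Spec G BallGame.parameters s
      (10 * (m + n + numInner G.A G.eps + numOuter G.A G.eps) + 100) fun s' =>
    Spec G (BallGame.clear .center .x) s' (n * 3 + 2) fun s' =>
    Spec G (BallGame.clear .center .y) s' (m * 3 + 2) fun s' =>
    Spec G (BallGame.clear .total .x) s' (n * 3 + 2) fun s' =>
    Spec G (BallGame.clear .total .y) s' (m * 3 + 2) fun s' => OuterInv G 0 s' 0 0 0 := by
  refine Spec.parameters.mono le_rfl fun s1 h1 => (Spec.clear rfl).mono le_rfl fun s2 h2 =>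
    (Spec.clear rfl).mono le_rfl fun s3 h3 => (Spec.clear rfl).mono le_rfl fun s4 h4 =>
    (Spec.clear rfl).mono le_rfl fun s5 h5 => ⟨⟨?_, ?_, ?_⟩, by simp, by simp⟩
  · exact h1.1.congr fun r _ => by rw [h5.1, h4.1, h3.1, h2.1]
  · refine point_eq ?_ ?_
    · rw [State.vec_congr (h5.2.1 _ _ (by simp)), State.vec_congr (h4.2.1 _ _ (by simp)),
        State.vec_congr (h3.2.1 _ _ (by simp))]
      exact h2.2.2
    · rw [State.vec_congr (h5.2.1 _ _ (by simp)), State.vec_congr (h4.2.1 _ _ (by simp))]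
      exact h3.2.2
  · refine point_eq ?_ h5.2.2
    rw [State.vec_congr (h5.2.1 _ _ (by simp))]
    exact h4.2.2

theorem Spec.storeOut {k : ℕ} {z H : Joint m n} {R : ℝ} (h : OuterInv G k s z H R)
    (hk : k = numOuter G.A G.eps) :
    Spec G (.loop .l .cols (.store .out .x .l (.cell .total .x .l / Reg.numK)) ⨟
      .loop .l .rows (.store .out .y .l (.cell .total .y .l / Reg.numK))) s (20 * (n + m) + 10)
      fun s' => s'.point m n .out = (k : ℝ)⁻¹ • H := by
  refine Spec.mono (Spec.seq (Spec.store_div (f := H .x) (d := n) (N := k) rfl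
    (by rw [h.params.numK, hk]) fun j s' h1 h2 h3 => ?_) fun s1 h1 =>
    (Spec.store_div (f := H .y) (d := m) (N := k) rfl (by rw [h1.1, h.params.numK, hk])
      fun j s' h4 h5 h6 => ?_).mono le_rfl fun s2 h2 => ?_)
    (by simp [RExp.cost]; omega) fun _ h => h
  · rw [← h.total]
    simp only [RExp.eval, h2 .total .x (by simp), h3]
    rfl
  · rw [← h.total]
    simp only [RExp.eval, h5 .total .y (by simp), h6, h1.2.1 .total .y (by simp)]
    rfl
  · exact point_eq ((State.vec_congr (h2.2.1 _ _ (by simp)) n).trans h1.2.2) h2.2.2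

theorem ceil_numK (h : Params G s) : ⌈(RExp.reg .numK).eval G s⌉₊ = numOuter G.A G.eps := by
  rw [RExp.eval_reg, h.numK, Nat.ceil_natCast]

theorem Spec.vrCoordinateMethod (hA : Regular G.A) (hε : 0 < G.eps) :
    Spec G vrCoordinateMethod s ((numOuter G.A G.eps + 1) *
      (2000 * (m + n + nnz G.A + numInner G.A G.eps + 1))) fun s' =>
        ∀ β, ‖s'.point m n .out β‖ ≤ 1 := by
  have h5 : ∀ s', OuterInv G 0 s' 0 0 0 → Spec G (Prog.loop .k (.reg .numK) BallGame.outerBody) s'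
      (numOuter G.A G.eps * (1100 * (m + n + nnz G.A + numInner G.A G.eps + 1) + 1) + 2)
      fun s' => ∃ z H R, OuterInv G (numOuter G.A G.eps) s' z H R :=
    fun s' h' => Spec.loop (fun k s' => ∃ z H R, OuterInv G k s' z H R) (ceil_numK h'.params)
      ⟨_, _, _, h'⟩ fun k _ s' ⟨_, _, _, h⟩ =>
        (Spec.outerBody hA hε (h.setIdx .k k)).mono le_rfl fun _ h => ⟨_, _, _, h⟩
  have h6 : ∀ s', (∃ z H R, OuterInv G (numOuter G.A G.eps) s' z H R) → Spec G
      (.loop .l .cols (.store .out .x .l (.cell .total .x .l / Reg.numK)) ⨟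
      .loop .l .rows (.store .out .y .l (.cell .total .y .l / Reg.numK))) s' (20 * (n + m) + 10)
      fun s' => ∀ β, ‖s'.point m n .out β‖ ≤ 1 := by
    rintro s' ⟨z, H, R, hs⟩
    have h7 := Spec.storeOut hs rfl
    refine h7.mono le_rfl fun s7 h7 β => ?_
    rw [h7, PiLp.smul_apply, norm_smul, norm_inv, Real.norm_natCast]
    exact inv_mul_le_one_of_le₀ (hs.norm_sum_le β) (Nat.cast_nonneg _)
  refine Spec.mono (Spec.seq Spec.initOuter fun _ h1 => Spec.seq h1 fun _ h2 => Spec.seq h2 fun _ h3 =>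
    Spec.seq h3 fun _ h4 => Spec.seq h4 fun s' h => Spec.seq (h5 s' h) h6) ?_ fun _ h => h
  generalize nnz G.A = N
  generalize numInner G.A G.eps = T
  generalize numOuter G.A G.eps = K
  nlinarith [Nat.zero_le (K * N), Nat.zero_le (K * T), Nat.zero_le (K * m), Nat.zero_le (K * n)]

theorem output_eq (s : State) : s.output m n = (s.point m n .out .x, s.point m n .out .y) := rfl

theorem numOuter_pos (hε : 0 < G.eps) : 0 < numOuter G.A G.eps :=
  Nat.ceil_pos.2 (div_pos (alphaOpt_pos hε) hε)

theorem mean_gap_le (hA : Regular G.A) (hε : 0 < G.eps) :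
    vrCoordinateMethod.mean G s (fun s' => gap G.A G.b G.c (s'.output m n)) ≤ G.eps := by
  have hK := numOuter_pos (G := G) hε
  have hK' : (0 : ℝ) < numOuter G.A G.eps := Nat.cast_pos.2 hK
  unfold vrCoordinateMethod
  rw [Prog.mean_seq]
  refine Prog.mean_le Spec.initOuter fun s1 h1 => ?_
  rw [Prog.mean_seq]
  refine Prog.mean_le h1 fun s2 h2 => ?_
  rw [Prog.mean_seq]
  refine Prog.mean_le h2 fun s3 h3 => ?_
  rw [Prog.mean_seq]
  refine Prog.mean_le h3 fun s4 h4 => ?_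
  rw [Prog.mean_seq]
  refine Prog.mean_le h4 fun s5 h5 => ?_
  rw [Prog.mean_seq]
  refine (Prog.mean_loop_le (fun k s (γ : Joint m n × Joint m n × ℝ) => OuterInv G k s γ.1 γ.2.1 γ.2.2)
    (fun γ => (numOuter G.A G.eps : ℝ)⁻¹ * (alphaOpt G.A G.eps + γ.2.2)) (γ := (0, 0, 0))
    (ceil_numK h5.params) h5 (fun k hk s' γ hγ => ⟨fun s'' => (s''.point m n .center,
      s''.point m n .total, G.nextRegret γ.1 γ.2.2 s''),
      ⟨_, Spec.outerBody hA hε (hγ.setIdx .k k)⟩, ?_⟩) fun s' γ hγ => ?_).trans ?_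
  · have h6 := mean_nextRegret_le hA hε γ.2.2 (hγ.setIdx .k k).toOuter
    simp only [mul_add]
    rw [Prog.mean_const_add_mul]
    exact add_le_add_right (mul_le_mul_of_nonneg_left h6 (by positivity)) _
  · have h5 := Spec.storeOut hγ rfl
    refine Prog.mean_le h5 fun s6 h6 => ?_
    have h7 := hγ.gap_le hK hε h6
    rw [output_eq]
    exact h7
  -- The initial potential is α/K, and K = ⌈α/ε⌉.
  · rw [add_zero, inv_mul_le_iff₀ hK', ← div_le_iff₀ hε]
    exact Nat.le_ceil _

end outer

/-! ## The time bound -/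

section time

variable {m n : ℕ} {A : Matrix (Fin m) (Fin n) ℝ} {ε : ℝ}

theorem alphaOpt_eq (A : Matrix (Fin m) (Fin n) ℝ) (ε : ℝ) :
    alphaOpt A ε = max ε (Lco A / √(nnz A)) := by
  rw [alphaOpt, Real.sqrt_div zero_le_one, Real.sqrt_one, mul_one_div]

theorem rows_le_nnz (hrow : ∀ i, ∃ j, A i j ≠ 0) : m ≤ nnz A := by
  choose f hf using hrow
  have h := Nat.card_le_card_of_injective (fun i => (⟨(i, f i), hf i⟩ : {p : Fin m × Fin n // A p.1 p.2 ≠ 0}))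
    fun i i' h => congrArg (fun p => p.1.1) h
  rwa [Nat.card_eq_fintype_card, Fintype.card_fin] at h

theorem cols_le_nnz (hcol : ∀ j, ∃ i, A i j ≠ 0) : n ≤ nnz A := by
  choose f hf using hcol
  have h := Nat.card_le_card_of_injective (fun j => (⟨(f j, j), hf j⟩ : {p : Fin m × Fin n // A p.1 p.2 ≠ 0}))
    fun i i' h => congrArg (fun p => p.1.2) h
  rwa [Nat.card_eq_fintype_card, Fintype.card_fin] at h

/-- Up to the factor 1/ε, the bound is α ↦ nnz·α + L²/α, which decreases up to L/√nnz and increases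
afterwards. On [ε, ∞) its minimum is thus at the larger of ε and L/√nnz; explicit factorizations of
the difference replace calculus. -/
theorem timeBound_alphaOpt_le_timeBound (hN : 0 < nnz A) (hε : 0 < ε) {α : ℝ} (hα : ε ≤ α) :
    timeBound A ε (alphaOpt A ε) ≤ timeBound A ε α := by
  have hN' : (0 : ℝ) < nnz A := Nat.cast_pos.2 hN
  have hα' : 0 < α := hε.trans_le hα
  have h0 : 0 ≤ Lco A := Real.sqrt_nonneg _
  have key : ∀ β : ℝ, 0 < β → timeBound A ε β = (nnz A * β + Lco A ^ 2 / β) / ε := by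
    intro β hβ
    rw [timeBound]
    field_simp
  have hr : 0 < √(nnz A : ℝ) := Real.sqrt_pos.2 hN'
  have hr2 : √(nnz A : ℝ) ^ 2 = nnz A := Real.sq_sqrt hN'.le
  rw [key _ hα', key _ (alphaOpt_pos hε), alphaOpt_eq]
  refine div_le_div_of_nonneg_right ?_ hε.le
  generalize √(nnz A : ℝ) = r at *
  generalize Lco A = L at *
  rw [← hr2]
  rcases le_total (L / r) ε with h | h
  · rw [max_eq_left h]
    rw [div_le_iff₀ hr] at h
    have h1 : r ^ 2 * α + L ^ 2 / α - (r ^ 2 * ε + L ^ 2 / ε) =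
        (α - ε) * (r ^ 2 * (α * ε) - L ^ 2) / (α * ε) := by
      field_simp
      ring
    have h2 : L ^ 2 ≤ r ^ 2 * (α * ε) := by
      calc L ^ 2 ≤ (ε * r) ^ 2 := pow_le_pow_left₀ h0 h 2
        _ = r ^ 2 * (ε * ε) := by ring
        _ ≤ r ^ 2 * (α * ε) := by gcongr
    have h3 : 0 ≤ (α - ε) * (r ^ 2 * (α * ε) - L ^ 2) / (α * ε) :=
      div_nonneg (mul_nonneg (sub_nonneg.2 hα) (sub_nonneg.2 h2)) (by positivity)
    linarith
  · rw [max_eq_right h]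
    have hL : 0 < L := by
      by_contra hL
      have : L = 0 := le_antisymm (not_lt.1 hL) h0
      rw [this, zero_div] at h
      exact absurd h (not_le.2 hε)
    have h1 : r ^ 2 * α + L ^ 2 / α - (r ^ 2 * (L / r) + L ^ 2 / (L / r)) = (r * α - L) ^ 2 / α := by
      field_simp
      ring
    have h2 : 0 ≤ (r * α - L) ^ 2 / α := by positivity
    linarith

/-- If α = L/√nnz, both summands equal √nnz·L/ε. If α = ε, then L/ε ≤ √nnz gives L²/ε² ≤ √nnz·L/ε.
-/
theorem timeBound_alphaOpt_le (hN : 0 < nnz A) (hε : 0 < ε) :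
    timeBound A ε (alphaOpt A ε) ≤ 2 * (nnz A + √(nnz A) * Lco A / ε) := by
  have hN' : (0 : ℝ) < nnz A := Nat.cast_pos.2 hN
  have h0 : 0 ≤ Lco A := Real.sqrt_nonneg _
  have hr : 0 < √(nnz A : ℝ) := Real.sqrt_pos.2 hN'
  have hr2 : √(nnz A : ℝ) ^ 2 = nnz A := Real.sq_sqrt hN'.le
  rw [timeBound, alphaOpt_eq]
  generalize √(nnz A : ℝ) = r at *
  generalize Lco A = L at *
  rw [← hr2]
  have h4 : 0 ≤ r * L / ε := by positivity
  rcases le_total (L / r) ε with h | h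
  · rw [max_eq_left h, div_self hε.ne', mul_one]
    rw [div_le_iff₀ hr, mul_comm, ← div_le_iff₀ hε] at h
    have h1 : L ^ 2 / ε ^ 2 ≤ r * L / ε := by
      calc L ^ 2 / ε ^ 2 = L / ε * (L / ε) := by ring
        _ ≤ r * (L / ε) := by gcongr
        _ = r * L / ε := by ring
    have h2 : 0 ≤ r ^ 2 := sq_nonneg r
    linarith
  · rw [max_eq_right h]
    have hL : L ≠ 0 := by
      rintro rfl
      rw [zero_div] at h
      exact absurd h (not_le.2 hε)
    have h1 : (r ^ 2 + L ^ 2 / (L / r) ^ 2) * (L / r / ε) = 2 * (r * L / ε) := by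
      field_simp
      ring
    have h2 : 0 ≤ r ^ 2 := sq_nonneg r
    linarith

theorem cost_le_timeBound (hA : Regular A) (hε : 0 < ε) (hN : 0 < nnz A) (hm : m ≤ nnz A)
    (hn : n ≤ nnz A) :
    (((numOuter A ε + 1) * (2000 * (m + n + nnz A + numInner A ε + 1)) : ℕ) : ℝ) ≤
      720000 * timeBound A ε (alphaOpt A ε) := by
  have hα : 0 < alphaOpt A ε := alphaOpt_pos hε
  have hL := hA.Lco_pos
  have h1 : (1 : ℝ) ≤ alphaOpt A ε / ε := (one_le_div hε).2 (le_max_left _ _)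
  have h2 : (numOuter A ε : ℝ) < alphaOpt A ε / ε + 1 := Nat.ceil_lt_add_one (by linarith)
  have h3 : 6 / (etaOpt A ε * alphaOpt A ε) = 120 * (Lco A ^ 2 / alphaOpt A ε ^ 2) := by
    rw [etaOpt]
    field_simp
    norm_num
  have h4 : (numInner A ε : ℝ) < 120 * (Lco A ^ 2 / alphaOpt A ε ^ 2) + 1 := by
    rw [← h3]
    have := etaOpt_pos hA hε
    exact Nat.ceil_lt_add_one (by positivity)
  have hN' : (1 : ℝ) ≤ nnz A := Nat.one_le_cast.2 hN
  have hm' : (m : ℝ) ≤ nnz A := Nat.cast_le.2 hm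
  have hn' : (n : ℝ) ≤ nnz A := Nat.cast_le.2 hn
  push_cast
  -- Since α/ε ≥ 1, K + 1 ≤ 3α/ε. Since 1, m, n ≤ nnz, the other sum is at most 5 nnz + 120 L²/α².
  -- Finally 3 · 2000 · 120 = 720000.
  calc ((numOuter A ε : ℝ) + 1) * (2000 * (m + n + nnz A + numInner A ε + 1))
      ≤ (3 * (alphaOpt A ε / ε)) * (2000 * (120 * (nnz A + Lco A ^ 2 / alphaOpt A ε ^ 2))) := by
        gcongr <;> linarith
    _ = 720000 * timeBound A ε (alphaOpt A ε) := by
        rw [timeBound]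
        ring

end time

end BallGame

theorem mainTheorem3 :
    ∃ C : ℝ, 0 < C ∧ ∀ (m n : ℕ) (G : BallGame.Game m n), 0 < m → 0 < n →
      (∀ i, ∃ j, G.A i j ≠ 0) → (∀ j, ∃ i, G.A i j ≠ 0) → 0 < G.eps →
      -- every execution: the output is feasible and the number of steps is bounded
      (∀ r ∈ (BallGame.execution G).support,
        r.1.output m n ∈ BallGame.unitBall n ×ˢ BallGame.unitBall m ∧
        (r.2 : ℝ) ≤ C * BallGame.timeBound G.A G.eps (BallGame.alphaOpt G.A G.eps)) ∧
      BallGame.timeBound G.A G.eps (BallGame.alphaOpt G.A G.eps) ≤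
        C * (BallGame.nnz G.A + √(BallGame.nnz G.A) * BallGame.Lco G.A / G.eps) ∧
      -- the choice of the parameter is optimal
      (∀ α : ℝ, G.eps ≤ α → BallGame.timeBound G.A G.eps (BallGame.alphaOpt G.A G.eps) ≤
        BallGame.timeBound G.A G.eps α) ∧
      -- the expected duality gap
      Summable (fun r : BallGame.State × ℕ => ((BallGame.execution G) r).toReal *
        BallGame.gap G.A G.b G.c (r.1.output m n)) ∧
      ∑' r : BallGame.State × ℕ, ((BallGame.execution G) r).toReal *
        BallGame.gap G.A G.b G.c (r.1.output m n) ≤ G.eps := by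
  refine ⟨720000, by norm_num, fun m n G hm hn hrow hcol hε => ?_⟩
  have hA := BallGame.Regular.of_exists_ne_zero hm hn hrow hcol
  have hmN := BallGame.rows_le_nnz hrow
  have hN := hm.trans_le hmN
  refine ⟨fun r hr => ?_, ?_, fun α hα => BallGame.timeBound_alphaOpt_le_timeBound hN hε hα,
    BallGame.summable_expect (BallGame.run_support_finite G _ _) _, BallGame.mean_gap_le hA hε⟩
  · have h := BallGame.Spec.vrCoordinateMethod hA hε r hr
    refine ⟨?_, (Nat.cast_le.2 h.1).trans
      (BallGame.cost_le_timeBound hA hε hN hmN (BallGame.cols_le_nnz hcol))⟩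
    rw [BallGame.output_eq]
    exact ⟨mem_closedBall_zero_iff.2 (h.2 .x), mem_closedBall_zero_iff.2 (h.2 .y)⟩
  · refine (BallGame.timeBound_alphaOpt_le hN hε).trans (mul_le_mul_of_nonneg_right (by norm_num) ?_)
    have : 0 ≤ BallGame.Lco G.A := hA.Lco_pos.le
    positivity
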